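/- \textbf{Ribbon presentations.} A ribbon presentation consists of finitely many disjoint oriented disks, one of them the based disk $D_0$, joined by bands along a tree (so that the union is an immersed disk in $\mathbb R^3$); a band may cross the interiors of disks. Orient the core of every band towards $D_0$; a crossing of a band with a disk is positive or negative according to whether the core gives the positive or negative normal of the disk. Presentations are described by their disks, the bands in the order of attachment, and, for each band, the sequence of signed crossings along it (bands may be passed through one another). Some crossings carry a label $\star$ and are numbered $1,\dots,k$. A \emph{node} is a disk that no band crosses. The \emph{trivial presentation} is $D_0$ alone. Two presentations are \emph{equivalent} if they are related by the following moves and their inverses, performed at crossings without $\star$: (S1) a disk that no band crosses and to which exactly one band is attached is drawn back along this band and deleted together with it; (S2) two consecutive opposite crossings of a band with the same disk cancel; (S4) if a band with crossing sequence $\beta$ joins a disk $D$ to a disk $E$ (oriented from $D$ to $E$), a crossing of another band with $D$ is replaced by $\beta$, a crossing of the same sign with $E$, and $\beta^{-1}$; (S7) the order of attachment of bands is changed. A \emph{cross-change move} at a node $N$ adds a new disk, joined to $N$ by a band without crossings (a copy of $N$), and makes one band cross this new disk once, without label $\star$. For $\varepsilon\in\{\pm1\}^k$ and a presentation $P$ with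 labelled crossings, $P(\varepsilon)$ is obtained from $P$ by removing the label of the $i$-th crossing if $\varepsilon_i=1$, and by taking the disk off the band at the $i$-th crossing if $\varepsilon_i=-1$. \textbf{The presentation $P(\Theta(p,q,r))$.} Let $p,r\ge1$, $q\ge0$, $k=p+q+r+1$. In the graph $\Theta$, orient the upper edge from the left to the right vertex and the middle and lower edges from the right to the left vertex, and attach $p,q,r$ hairs to the upper, middle and lower edge. Replace each hair by an oriented line with one outgoing, then one incoming end of a chord; the leftmost upper hair instead gets two outgoing and then one incoming end, and the rightmost lower hair one outgoing and then two incoming ends. Chords run from each hair to the preceding hair(s) along the oriented edges. (The two chords leaving the leftmost upper hair go to the middle and the lower edge, or directly to the rightmost lower hair if the latter is the next one; any distribution of these two chords, and any order of the two incoming ends on the rightmost lower hair, is allowed.) The ribbon presentation $P(\Theta(p,q,r))$ has one white disk for the outgoing end of each chord. For each line, a band runs along it and ends at $D_0$; it starts at the white disk of the first vertex, except that on the line of the leftmost upper hair it starts at a gray disk, to which the white disks of both outgoing ends are joined by bands without crossings; each incoming end of a chord is a positive crossing, labelled $\star$, of this band with the white disk of the chord. Let $Q$ be the part formed by the gray disk,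 which is a node, and its two white disks. \textbf{Statement.} There is a presentation $P'(\Theta(p,q,r))$, obtained from $P(\Theta(p,q,r))$ by finitely many cross-change moves at the gray node of $Q$, such that: (a) $P'(\Theta(p,q,r))(1,\dots,1)$ is equivalent to the trivial presentation; (b) for every $\varepsilon\in\{\pm1\}^k$ with some $\varepsilon_i=-1$, each of $P(\Theta(p,q,r))(\varepsilon)$ and $P'(\Theta(p,q,r))(\varepsilon)$ is equivalent to a presentation containing $Q$ in which at least one of the two white disks of $Q$ is a node. Moreover the equivalence keeps $Q$: every presentation on the way contains the gray disk as a node and the two white disks, each joined to the gray disk by a band without crossings and having no other band attached, and no crossing is pushed (S4) along these two bands. -/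

import Mathlib

/-! Ribbon presentations, encoded by their disks, their bands and the crossings met along the
bands, the ribbon presentations of chord diagrams on oriented lines, and the moves on them.

Nothing else about an immersed disk in `ℝ³` is recorded: how bands are knotted, twisted, or pass over one another is
irrelevant, since bands may be passed through each other without changing the ribbon knots. -/

/-- Names of the disks of ribbon presentations whose marked crossings are numbered by `Fin k`:
the based disk `D₀`, the white disk of the `j`-th chord, the (gray) disk in the interior of an
oriented line from which the white disk of the `j`-th chord branches off, and a supply of names for
disks created by moves. Moves never rename a disk. -/
inductive RibbonDisk (k : ℕ) : Type
  | base : RibbonDisk k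
  | white (j : Fin k) : RibbonDisk k
  | gray (j : Fin k) : RibbonDisk k
  | extra (n : ℕ) : RibbonDisk k

/-- A crossing of a band with the interior of the disk `disk`. Its sign is `1` if the core of the
band, oriented towards `D₀`, gives the oriented normal vector of the disk, and `-1` otherwise.
`star = some j` means that it carries the label `⋆` and is the `j`-th crossing to be perturbed;
`star = none` means that it has no label. -/
structure RibbonCrossing (k : ℕ) : Type where
  disk : RibbonDisk k
  sign : ℤˣ
  star : Option (Fin k)

/-- A band, its core oriented towards `D₀`: it leaves the disk `tail`, meets the crossings of
`word` in this order, and arrives at the disk `head`. -/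
structure RibbonBand (k : ℕ) : Type where
  tail : RibbonDisk k
  head : RibbonDisk k
  word : List (RibbonCrossing k)

/-- Some band of the list leads from the disk `d` to the disk `e`. -/
def RibbonStep {k : ℕ} (bands : List (RibbonBand k)) (d e : RibbonDisk k) : Prop :=
  ∃ b ∈ bands, b.tail = d ∧ b.head = e

/-- A ribbon presentation: disks joined by bands along a tree rooted at `D₀` (their union is an
immersed disk), the bands running through interiors of disks. As the tree is rooted, each disk
other than `D₀` is the tail of exactly one band, so the disks are `D₀` and the tails. The order of
the list is the order in which bands are attached to the disks. The order of the presentation is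
the length of the list. -/
structure RibbonPresentation (k : ℕ) : Type where
  bands : List (RibbonBand k)
  tails_nodup : (bands.map RibbonBand.tail).Nodup
  base_not_tail : ∀ b ∈ bands, b.tail ≠ RibbonDisk.base
  connected : ∀ b ∈ bands, Relation.ReflTransGen (RibbonStep bands) b.tail RibbonDisk.base
  crossing_mem : ∀ b ∈ bands, ∀ c ∈ b.word,
    c.disk = RibbonDisk.base ∨ c.disk ∈ bands.map RibbonBand.tail

theorem RibbonStep.mono {k : ℕ} {l l' : List (RibbonBand k)}
    (h : ∀ d e, RibbonStep l d e → RibbonStep l' d e) {d e : RibbonDisk k}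
    (hd : Relation.ReflTransGen (RibbonStep l) d e) :
    Relation.ReflTransGen (RibbonStep l') d e := by
  induction hd with
  | refl => exact Relation.ReflTransGen.refl
  | tail _ h2 ih => exact Relation.ReflTransGen.tail ih (h _ _ h2)

namespace RibbonPresentation

variable {k : ℕ}

/-- `d` is one of the disks of `P`. -/
def HasDisk (P : RibbonPresentation k) (d : RibbonDisk k) : Prop :=
  d = RibbonDisk.base ∨ d ∈ P.bands.map RibbonBand.tail

/-- A node: a disk that no band intersects. -/
def IsNode (P : RibbonPresentation k) (d : RibbonDisk k) : Prop :=
  P.HasDisk d ∧ ∀ b ∈ P.bands, ∀ c ∈ b.word, c.disk ≠ d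

/-- The trivial presentation: the based disk alone. -/
def trivialPresentation (k : ℕ) : RibbonPresentation k where
  bands := []
  tails_nodup := by simp
  base_not_tail := by simp
  connected := by simp
  crossing_mem := by simp

/-! ### Resolving the marked crossings -/

/-- The effect of signs `ε` on one crossing: an unlabelled crossing stays; the `j`-th crossing
loses its label if `ε j = 1`, and is removed (the disk is taken off the band) if `ε j = -1`. -/
def resolveCrossing (ε : Fin k → ℤˣ) (c : RibbonCrossing k) : Option (RibbonCrossing k) :=
  match c.star with
  | none => some c
  | some j => if ε j = 1 then some ⟨c.disk, c.sign, none⟩ else none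

def resolveBand (ε : Fin k → ℤˣ) (b : RibbonBand k) : RibbonBand k :=
  ⟨b.tail, b.head, b.word.filterMap (resolveCrossing ε)⟩

theorem disk_of_resolveCrossing {ε : Fin k → ℤˣ} {c c' : RibbonCrossing k}
    (h : resolveCrossing ε c = some c') : c'.disk = c.disk := by
  unfold resolveCrossing at h
  split at h
  · simp_all
  · split at h
    · simp only [Option.some.injEq] at h
      rw [← h]
    · simp at h

theorem map_tail_resolveBand (ε : Fin k → ℤˣ) (l : List (RibbonBand k)) :
    (l.map (resolveBand ε)).map RibbonBand.tail = l.map RibbonBand.tail := by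
  simp [resolveBand, Function.comp_def]

/-- The presentation `P(ε₁, …, ε_k)`. -/
def resolve (P : RibbonPresentation k) (ε : Fin k → ℤˣ) : RibbonPresentation k where
  bands := P.bands.map (resolveBand ε)
  tails_nodup := by
    rw [map_tail_resolveBand]
    exact P.tails_nodup
  base_not_tail := by
    intro b hb
    obtain ⟨a, ha, rfl⟩ := List.mem_map.1 hb
    exact P.base_not_tail a ha
  connected := by
    intro b hb
    obtain ⟨a, ha, rfl⟩ := List.mem_map.1 hb
    refine RibbonStep.mono ?_ (P.connected a ha)
    rintro d e ⟨b, hb, h1, h2⟩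
    exact ⟨resolveBand ε b, List.mem_map_of_mem hb, h1, h2⟩
  crossing_mem := by
    intro b hb c hc
    obtain ⟨a, ha, rfl⟩ := List.mem_map.1 hb
    obtain ⟨c', hc', h⟩ := List.mem_filterMap.1 hc
    rw [map_tail_resolveBand, disk_of_resolveCrossing h]
    exact P.crossing_mem a ha c' hc'

/-! ### Moves -/

/-- The crossings of a piece of band traversed backwards. -/
def reverseWord (w : List (RibbonCrossing k)) : List (RibbonCrossing k) :=
  (w.map fun c => ⟨c.disk, -c.sign, c.star⟩).reverse

/-- `R` arises from `P` by changing the crossings along the band from `t` to `h` from `w` to `w'`;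
`rest` are the other bands. -/
def Rewrite (P R : RibbonPresentation k) (t h : RibbonDisk k) (w w' : List (RibbonCrossing k))
    (rest : List (RibbonBand k)) : Prop :=
  ∃ l₁ l₂, rest = l₁ ++ l₂ ∧
    P.bands = l₁ ++ ⟨t, h, w⟩ :: l₂ ∧ R.bands = l₁ ++ ⟨t, h, w'⟩ :: l₂

/-- Move S1 (deleting direction): a disk that no band intersects and to which exactly one band is
attached is drawn back along its band, through whatever disks this band intersects, and deleted
with it. The other direction creates such a disk, in particular a copy of a disk, joined to it by a
band without crossings. -/
def MoveS1 (P R : RibbonPresentation k) : Prop :=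
  ∃ l₁ b l₂, P.bands = l₁ ++ b :: l₂ ∧ R.bands = l₁ ++ l₂ ∧ P.IsNode b.tail ∧
    ∀ a ∈ P.bands, a.head ≠ b.tail

/-- Move S2: two consecutive opposite crossings of a band with the same disk cancel. -/
def MoveS2 (P R : RibbonPresentation k) : Prop :=
  ∃ t h u v d s rest, P.Rewrite R t h (u ++ ⟨d, s, none⟩ :: ⟨d, -s, none⟩ :: v) (u ++ v) rest

/-- Move S4 at the disk `d`: if a band with crossings `β` joins the disk `d` to the disk `e`, a
crossing of another band with `d` is pushed along it: the other band now follows `β`, crosses `e`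
with the same sign, and comes back along `β`. -/
def MoveS4 (d : RibbonDisk k) (P R : RibbonPresentation k) : Prop :=
  ∃ t h u v s rest e β, (⟨d, e, β⟩ : RibbonBand k) ∈ rest ∧ (∀ c ∈ β, c.star = none) ∧
    P.Rewrite R t h (u ++ ⟨d, s, none⟩ :: v)
      (u ++ (β ++ ⟨e, s, none⟩ :: reverseWord β) ++ v) rest

/-- Move S7: the order in which bands are attached to the disks is changed. -/
def MoveS7 (P R : RibbonPresentation k) : Prop :=
  P.bands.Perm R.bands

/-- Equivalence of ribbon presentations: the equivalence relation generated by the moves. -/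
def Equivalent : RibbonPresentation k → RibbonPresentation k → Prop :=
  Relation.EqvGen fun P R => MoveS1 P R ∨ MoveS2 P R ∨ (∃ d, MoveS4 d P R) ∨ MoveS7 P R

/-- `P` contains the part `Q` formed by the node `n` and the two white disks `w₁`, `w₂`: each white
disk is joined to `n` by a band without crossings, and no other band is attached to it. -/
structure HasPartQ (P : RibbonPresentation k) (w₁ w₂ n : RibbonDisk k) : Prop where
  band₁ : (⟨w₁, n, []⟩ : RibbonBand k) ∈ P.bands
  band₂ : (⟨w₂, n, []⟩ : RibbonBand k) ∈ P.bands
  only₁ : ∀ b ∈ P.bands, b.head ≠ w₁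
  only₂ : ∀ b ∈ P.bands, b.head ≠ w₂
  isNode : P.IsNode n

/-- Equivalence keeping the part `Q`: all presentations on the way contain `Q`, and no crossing is
pushed along one of the two bands that join the white disks of `Q` to its node. (Otherwise the
crossings could always be taken off a white disk, by pushing them to its node.) -/
def EquivalentKeepingQ (w₁ w₂ n : RibbonDisk k) :
    RibbonPresentation k → RibbonPresentation k → Prop :=
  Relation.EqvGen fun P R => P.HasPartQ w₁ w₂ n ∧ R.HasPartQ w₁ w₂ n ∧
    (MoveS1 P R ∨ MoveS2 P R ∨ (∃ d, d ≠ w₁ ∧ d ≠ w₂ ∧ MoveS4 d P R) ∨ MoveS7 P R)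

theorem EquivalentKeepingQ.equivalent {w₁ w₂ n : RibbonDisk k} {P R : RibbonPresentation k}
    (h : EquivalentKeepingQ w₁ w₂ n P R) : Equivalent P R := by
  have key : ∀ P R : RibbonPresentation k, (P.HasPartQ w₁ w₂ n ∧ R.HasPartQ w₁ w₂ n ∧
      (MoveS1 P R ∨ MoveS2 P R ∨ (∃ d, d ≠ w₁ ∧ d ≠ w₂ ∧ MoveS4 d P R) ∨ MoveS7 P R)) →
      (MoveS1 P R ∨ MoveS2 P R ∨ (∃ d, MoveS4 d P R) ∨ MoveS7 P R) := by
    rintro P R ⟨-, -, h | h | ⟨d, -, -, h⟩ | h⟩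
    · exact Or.inl h
    · exact Or.inr (Or.inl h)
    · exact Or.inr (Or.inr (Or.inl ⟨d, h⟩))
    · exact Or.inr (Or.inr (Or.inr h))
  induction h with
  | rel P R h => exact Relation.EqvGen.rel _ _ (key P R h)
  | refl P => exact Relation.EqvGen.refl _
  | symm P R _ ih => exact Relation.EqvGen.symm _ _ ih
  | trans P R S _ _ ih1 ih2 => exact Relation.EqvGen.trans _ _ _ ih1 ih2

/-- Cross-change move at the node `n`: a copy of `n` is made (a new disk `d`, joined to `n` by a
band without crossings), and some band is made to intersect this copy once, at any place, with any
sign. The new crossing carries no label `⋆`. -/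
def CrossChange (n : RibbonDisk k) (P R : RibbonPresentation k) : Prop :=
  P.IsNode n ∧ ∃ d l₁ t h u v s l₂, ¬ P.HasDisk d ∧
    P.bands = l₁ ++ ⟨t, h, u ++ v⟩ :: l₂ ∧
    R.bands = l₁ ++ ⟨t, h, u ++ ⟨d, s, none⟩ :: v⟩ :: l₂ ++ [⟨d, n, []⟩]

end RibbonPresentation

/-! ### Chord diagrams on oriented lines -/

/-- An end of a chord: the initial or the terminal point of the `j`-th oriented chord. -/
inductive ChordEnd (k : ℕ) : Type
  | init (j : Fin k) : ChordEnd k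
  | term (j : Fin k) : ChordEnd k

/-- An oriented line: its origin is the initial point of the chord `origin`; `rest` are the further
vertices, in order. -/
structure ChordLine (k : ℕ) : Type where
  origin : Fin k
  rest : List (ChordEnd k)

def ChordLine.ends {k : ℕ} (l : ChordLine k) : List (ChordEnd k) :=
  ChordEnd.init l.origin :: l.rest

/-- A chord diagram of order `k` on oriented lines: each of the two ends of each of the `k` ordered
and oriented chords is a vertex of exactly one line, exactly once. -/
structure ChordDiagram (k : ℕ) : Type where
  lines : List (ChordLine k)
  nodup : (lines.flatMap ChordLine.ends).Nodup
  complete : ∀ e : ChordEnd k, e ∈ lines.flatMap ChordLine.ends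

namespace ChordDiagram

variable {k : ℕ}

/-- The bands along the remaining part of an oriented line, starting at the disk `cur` with a band
that has already met the crossings `w`. A terminal point is a segment of the band where it crosses
the white disk of that chord; at an initial point the line passes through a gray disk, to which the
white disk of that chord is joined by a band without crossings; the line ends at `D₀`. -/
def lineBands (sgn : Fin k → ℤˣ) :
    RibbonDisk k → List (RibbonCrossing k) → List (ChordEnd k) → List (RibbonBand k)
  | cur, w, [] => [⟨cur, RibbonDisk.base, w⟩]
  | cur, w, ChordEnd.term j :: es =>
      lineBands sgn cur (w ++ [⟨RibbonDisk.white j, sgn j, some j⟩]) es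
  | cur, w, ChordEnd.init j :: es =>
      ⟨cur, RibbonDisk.gray j, w⟩ :: ⟨RibbonDisk.white j, RibbonDisk.gray j, []⟩ ::
        lineBands sgn (RibbonDisk.gray j) [] es

/-- The bands of all lines; the origin of a line is the white disk of the chord starting there. -/
def allBands (D : ChordDiagram k) (sgn : Fin k → ℤˣ) : List (RibbonBand k) :=
  D.lines.flatMap fun l => lineBands sgn (RibbonDisk.white l.origin) [] l.rest

/-- The disks that arise from a vertex of a line other than its origin. -/
def endDisks : ChordEnd k → List (RibbonDisk k)
  | ChordEnd.init j => [RibbonDisk.white j, RibbonDisk.gray j]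
  | ChordEnd.term _ => []

theorem tails_lineBands (sgn : Fin k → ℤˣ) (es : List (ChordEnd k)) :
    ∀ (cur : RibbonDisk k) (w : List (RibbonCrossing k)),
      (lineBands sgn cur w es).map RibbonBand.tail = cur :: es.flatMap endDisks := by
  induction es with
  | nil => intro cur w; simp [lineBands]
  | cons e es ih =>
    intro cur w
    cases e with
    | init j => simp [lineBands, endDisks, ih]
    | term j => simp [lineBands, endDisks, ih]

theorem connected_lineBands (sgn : Fin k → ℤˣ) (es : List (ChordEnd k)) :
    ∀ (cur : RibbonDisk k) (w : List (RibbonCrossing k)),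
      ∀ d ∈ cur :: es.flatMap endDisks,
        Relation.ReflTransGen (RibbonStep (lineBands sgn cur w es)) d RibbonDisk.base := by
  induction es with
  | nil =>
    intro cur w d hd
    simp only [List.flatMap_nil, List.mem_singleton] at hd
    subst hd
    exact Relation.ReflTransGen.single ⟨⟨d, RibbonDisk.base, w⟩, by simp [lineBands], rfl, rfl⟩
  | cons e es ih =>
    intro cur w d hd
    cases e with
    | term j =>
      simp only [lineBands]
      exact ih cur _ d (by simpa [endDisks] using hd)
    | init j =>
      simp only [lineBands]
      have key : ∀ d ∈ RibbonDisk.gray j :: es.flatMap endDisks,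
          Relation.ReflTransGen (RibbonStep (⟨cur, RibbonDisk.gray j, w⟩ ::
            ⟨RibbonDisk.white j, RibbonDisk.gray j, []⟩ ::
              lineBands sgn (RibbonDisk.gray j) [] es)) d RibbonDisk.base := by
        intro d hd
        refine RibbonStep.mono ?_ (ih (RibbonDisk.gray j) [] d hd)
        rintro a b ⟨c, hc, h1, h2⟩
        exact ⟨c, List.mem_cons_of_mem _ (List.mem_cons_of_mem _ hc), h1, h2⟩
      have hg := key (RibbonDisk.gray j) (by simp)
      simp only [List.flatMap_cons, endDisks, List.cons_append, List.nil_append,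
        List.mem_cons] at hd
      rcases hd with rfl | rfl | hd
      · exact Relation.ReflTransGen.head ⟨_, List.mem_cons_self, rfl, rfl⟩ hg
      · exact Relation.ReflTransGen.head
          ⟨_, List.mem_cons_of_mem _ List.mem_cons_self, rfl, rfl⟩ hg
      · exact key d (List.mem_cons.2 hd)

theorem crossings_lineBands (sgn : Fin k → ℤˣ) (es : List (ChordEnd k)) :
    ∀ (cur : RibbonDisk k) (w : List (RibbonCrossing k)),
      (∀ c ∈ w, ∃ j, c.disk = RibbonDisk.white j) →
      ∀ b ∈ lineBands sgn cur w es, ∀ c ∈ b.word, ∃ j, c.disk = RibbonDisk.white j := by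
  induction es with
  | nil =>
    intro cur w hw b hb
    simp only [lineBands, List.mem_singleton] at hb
    subst hb
    exact hw
  | cons e es ih =>
    intro cur w hw b hb
    cases e with
    | term j =>
      refine ih cur _ ?_ b hb
      intro c hc
      rcases List.mem_append.1 hc with hc | hc
      · exact hw c hc
      · exact ⟨j, by rw [List.mem_singleton.1 hc]⟩
    | init j =>
      simp only [lineBands, List.mem_cons] at hb
      rcases hb with rfl | rfl | hb
      · exact hw
      · simp
      · exact ih _ [] (by simp) b hb

theorem tails_allBands (D : ChordDiagram k) (sgn : Fin k → ℤˣ) :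
    (D.allBands sgn).map RibbonBand.tail =
      D.lines.flatMap fun l => RibbonDisk.white l.origin :: l.rest.flatMap endDisks := by
  simp only [allBands, List.map_flatMap, tails_lineBands]

theorem tails_sublist (L : List (ChordLine k)) :
    (L.flatMap fun l => RibbonDisk.white l.origin :: l.rest.flatMap endDisks).Sublist
      ((L.flatMap ChordLine.ends).flatMap endDisks) := by
  induction L with
  | nil => simp
  | cons l L ih =>
    simp only [List.flatMap_cons, List.flatMap_append, ChordLine.ends, endDisks,
      List.cons_append, List.nil_append]
    refine List.Sublist.cons_cons _ (List.Sublist.cons _ ?_)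
    exact (List.Sublist.refl _).append ih

theorem tails_allBands_nodup (D : ChordDiagram k) (sgn : Fin k → ℤˣ) :
    ((D.allBands sgn).map RibbonBand.tail).Nodup := by
  rw [tails_allBands]
  refine List.Nodup.sublist (tails_sublist _) ?_
  rw [List.nodup_flatMap]
  constructor
  · rintro (j | j) - <;> simp [endDisks]
  · refine List.Pairwise.imp ?_ D.nodup
    rintro (i | i) (j | j) h <;>
      simp_all [endDisks, Function.onFun, eq_comm]

theorem white_mem_tails (D : ChordDiagram k) (sgn : Fin k → ℤˣ) (j : Fin k) :
    RibbonDisk.white j ∈ (D.allBands sgn).map RibbonBand.tail := by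
  obtain ⟨l, hl, h⟩ := List.mem_flatMap.1 (D.complete (ChordEnd.init j))
  rw [tails_allBands, List.mem_flatMap]
  refine ⟨l, hl, ?_⟩
  rcases List.mem_cons.1 h with h | h
  · simp only [ChordEnd.init.injEq] at h
    rw [h]
    exact List.mem_cons_self
  · exact List.mem_cons_of_mem _ (List.mem_flatMap.2 ⟨_, h, by simp [endDisks]⟩)

/-- The ribbon presentation of a chord diagram on oriented lines whose chords carry signs. The
crossing given by the `j`-th chord is marked as the `j`-th crossing. -/
def ribbon (D : ChordDiagram k) (sgn : Fin k → ℤˣ) : RibbonPresentation k where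
  bands := D.allBands sgn
  tails_nodup := D.tails_allBands_nodup sgn
  base_not_tail := by
    intro b hb h
    have hm := List.mem_map_of_mem (f := RibbonBand.tail) hb
    rw [tails_allBands, h] at hm
    obtain ⟨l, -, hm⟩ := List.mem_flatMap.1 hm
    rcases List.mem_cons.1 hm with hm | hm
    · simp at hm
    · obtain ⟨e, -, he⟩ := List.mem_flatMap.1 hm
      cases e <;> simp [endDisks] at he
  connected := by
    intro b hb
    obtain ⟨l, hl, hb⟩ := List.mem_flatMap.1 hb
    have hm := List.mem_map_of_mem (f := RibbonBand.tail) hb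
    rw [tails_lineBands] at hm
    refine RibbonStep.mono ?_ (connected_lineBands sgn l.rest _ [] b.tail hm)
    rintro d e ⟨a, ha, h1, h2⟩
    exact ⟨a, List.mem_flatMap.2 ⟨l, hl, ha⟩, h1, h2⟩
  crossing_mem := by
    intro b hb c hc
    obtain ⟨l, hl, hb⟩ := List.mem_flatMap.1 hb
    obtain ⟨j, hj⟩ := crossings_lineBands sgn l.rest _ [] (by simp) b hb c hc
    rw [hj]
    exact Or.inr (D.white_mem_tails sgn j)

end ChordDiagram

/-! ### The chord diagram and the ribbon presentation of the hairy graph `Θ(p,q,r)`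

The edges of `Θ` are oriented: the upper edge (with `p` hairs) from the left to the right vertex,
the middle edge (`q` hairs) and the lower edge (`r` hairs) from the right to the left vertex. The
hairs of an edge are numbered from its tail; each hair gives an oriented line. Counting chords from
`0`, the first upper hair emits the chords `0` and `1`, the `i`-th upper hair (`2 ≤ i ≤ p`) the
chord `i`, the `i`-th middle hair the chord `p + i`, the `i`-th lower hair the chord `p + q + i`.

A chord runs from a hair to the preceding one along the oriented edges. There are two ways
to distribute the chords `0` and `1` between the middle and the lower edge, chosen by `x`, and two
orders of the two terminal points on the line of the first lower hair, chosen by `y`. -/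

namespace Theta

/-- The chord arriving at the `i`-th upper hair. -/
def upperIn (p q i : ℕ) : ℕ := if i < p then i + 1 else p + q + 1

/-- The chord arriving along the middle edge at its `i`-th hair, or, if `i = 0`, at the first lower
hair, which is next to the right vertex of `Θ`. -/
def middleIn (p q : ℕ) (x : Bool) (i : ℕ) : ℕ :=
  if i < q then p + i + 1 else if x then 1 else 0

/-- The chord arriving along the lower edge at its `i`-th hair. -/
def lowerIn (p q r : ℕ) (x : Bool) (i : ℕ) : ℕ :=
  if i < r then p + q + i + 1 else if x then 0 else 1

/-- The chord with number `n`. -/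
def chord (p q r n : ℕ) : Fin (p + q + r + 1) := Fin.ofNat (p + q + r + 1) n

/-- The line with one initial point and one terminal point of an ordinary hair. -/
def ordinaryLine (p q r out inc : ℕ) : ChordLine (p + q + r + 1) :=
  ⟨chord p q r out, [ChordEnd.term (chord p q r inc)]⟩

/-- The line of the first upper hair. -/
def firstUpperLine (p q r : ℕ) : ChordLine (p + q + r + 1) :=
  ⟨chord p q r 0, [ChordEnd.init (chord p q r 1), ChordEnd.term (chord p q r (upperIn p q 1))]⟩

/-- The line of the first lower hair. -/
def firstLowerLine (p q r : ℕ) (x y : Bool) : ChordLine (p + q + r + 1) :=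
  ⟨chord p q r (p + q + 1),
    if y then [ChordEnd.term (chord p q r (lowerIn p q r x 1)),
      ChordEnd.term (chord p q r (middleIn p q x 0))]
    else [ChordEnd.term (chord p q r (middleIn p q x 0)),
      ChordEnd.term (chord p q r (lowerIn p q r x 1))]⟩

def lines (p q r : ℕ) (x y : Bool) : List (ChordLine (p + q + r + 1)) :=
  firstUpperLine p q r ::
    (List.range' 2 (p - 1)).map (fun i => ordinaryLine p q r i (upperIn p q i)) ++
    (List.range' 1 q).map (fun i => ordinaryLine p q r (p + i) (middleIn p q x i)) ++
    firstLowerLine p q r x y ::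
    (List.range' 2 (r - 1)).map (fun i => ordinaryLine p q r (p + q + i) (lowerIn p q r x i))

theorem length_lines (p q r : ℕ) (hp : 1 ≤ p) (hr : 1 ≤ r) (x y : Bool) :
    ((lines p q r x y).flatMap ChordLine.ends).length = 2 * (p + q + r + 1) := by
  cases y <;>
  simp [lines, ordinaryLine, firstUpperLine, firstLowerLine, ChordLine.ends, List.length_flatMap,
    Function.comp_def] <;> omega

theorem complete_lines (p q r : ℕ) (hp : 1 ≤ p) (hr : 1 ≤ r) (x y : Bool)
    (e : ChordEnd (p + q + r + 1)) : e ∈ (lines p q r x y).flatMap ChordLine.ends := by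
  have hch : ∀ n (j : Fin (p + q + r + 1)), n = j.1 → chord p q r n = j := by
    rintro n j rfl
    apply Fin.ext
    simp [chord, Fin.ofNat, Nat.mod_eq_of_lt j.2]
  have hU : ∀ i, 2 ≤ i → i ≤ p →
      ordinaryLine p q r i (upperIn p q i) ∈ lines p q r x y := by
    intro i h1 h2
    have : i ∈ List.range' 2 (p - 1) := by simp [List.mem_range'_1]; omega
    simp only [lines, List.cons_append, List.append_assoc, List.mem_cons, List.mem_append]
    exact Or.inr (Or.inl (List.mem_map_of_mem
      (f := fun i => ordinaryLine p q r i (upperIn p q i)) this))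
  have hM : ∀ i, 1 ≤ i → i ≤ q →
      ordinaryLine p q r (p + i) (middleIn p q x i) ∈ lines p q r x y := by
    intro i h1 h2
    have : i ∈ List.range' 1 q := by simp [List.mem_range'_1]; omega
    simp only [lines, List.cons_append, List.append_assoc, List.mem_cons, List.mem_append]
    exact Or.inr (Or.inr (Or.inl (List.mem_map_of_mem
      (f := fun i => ordinaryLine p q r (p + i) (middleIn p q x i)) this)))
  have hL : ∀ i, 2 ≤ i → i ≤ r →
      ordinaryLine p q r (p + q + i) (lowerIn p q r x i) ∈ lines p q r x y := by
    intro i h1 h2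
    have : i ∈ List.range' 2 (r - 1) := by simp [List.mem_range'_1]; omega
    simp only [lines, List.cons_append, List.append_assoc, List.mem_cons, List.mem_append]
    exact Or.inr (Or.inr (Or.inr (Or.inr (List.mem_map_of_mem
      (f := fun i => ordinaryLine p q r (p + q + i) (lowerIn p q r x i)) this))))
  have hU1 : firstUpperLine p q r ∈ lines p q r x y := by simp [lines]
  have hL1 : firstLowerLine p q r x y ∈ lines p q r x y := by simp [lines]
  have mk : ∀ l ∈ lines p q r x y, e ∈ l.ends →
      e ∈ (lines p q r x y).flatMap ChordLine.ends :=
    fun l h1 h2 => List.mem_flatMap.2 ⟨l, h1, h2⟩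
  have tU : ∀ i j, 1 ≤ i → i ≤ p → e = ChordEnd.term j → upperIn p q i = j.1 →
      e ∈ (lines p q r x y).flatMap ChordLine.ends := by
    rintro i j h1 h2 rfl h
    rcases Nat.lt_or_ge i 2 with h3 | h3
    · obtain rfl : i = 1 := by omega
      exact mk _ hU1 (by simp [firstUpperLine, ChordLine.ends, hch _ _ h])
    · exact mk _ (hU i h3 h2) (by simp [ordinaryLine, ChordLine.ends, hch _ _ h])
  have tM : ∀ i j, i ≤ q → e = ChordEnd.term j → middleIn p q x i = j.1 →
      e ∈ (lines p q r x y).flatMap ChordLine.ends := by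
    rintro i j h2 rfl h
    rcases Nat.eq_zero_or_pos i with rfl | h3
    · exact mk _ hL1 (by cases y <;> simp [firstLowerLine, ChordLine.ends, hch _ _ h])
    · exact mk _ (hM i h3 h2) (by simp [ordinaryLine, ChordLine.ends, hch _ _ h])
  have tL : ∀ i j, 1 ≤ i → i ≤ r → e = ChordEnd.term j → lowerIn p q r x i = j.1 →
      e ∈ (lines p q r x y).flatMap ChordLine.ends := by
    rintro i j h1 h2 rfl h
    rcases Nat.lt_or_ge i 2 with h3 | h3
    · obtain rfl : i = 1 := by omega
      exact mk _ hL1 (by cases y <;> simp [firstLowerLine, ChordLine.ends, hch _ _ h])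
    · exact mk _ (hL i h3 h2) (by simp [ordinaryLine, ChordLine.ends, hch _ _ h])
  rcases e with j | j
  · have hj := j.2
    rcases Nat.lt_or_ge j.1 2 with h | h
    · refine mk _ hU1 ?_
      rcases (by omega : j.1 = 0 ∨ j.1 = 1) with h0 | h0
      · simp [firstUpperLine, ChordLine.ends, hch 0 j h0.symm]
      · simp [firstUpperLine, ChordLine.ends, hch 1 j h0.symm]
    rcases Nat.lt_or_ge p j.1 with h1 | h1
    · rcases Nat.lt_or_ge (p + q) j.1 with h2 | h2
      · rcases Nat.lt_or_ge (p + q + 1) j.1 with h3 | h3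
        · exact mk _ (hL (j.1 - p - q) (by omega) (by omega))
            (by simp [ordinaryLine, ChordLine.ends, hch (p + q + (j.1 - p - q)) j (by omega)])
        · exact mk _ hL1
            (by simp [firstLowerLine, ChordLine.ends, hch (p + q + 1) j (by omega)])
      · exact mk _ (hM (j.1 - p) (by omega) (by omega))
          (by simp [ordinaryLine, ChordLine.ends, hch (p + (j.1 - p)) j (by omega)])
    · exact mk _ (hU j.1 h h1) (by simp [ordinaryLine, ChordLine.ends, hch j.1 j rfl])
  · have hj := j.2
    rcases Nat.lt_or_ge j.1 2 with h | h
    · rcases (by omega : j.1 = 0 ∨ j.1 = 1) with h0 | h0 <;> cases x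
      · exact tM q j le_rfl rfl (by simp [middleIn, h0])
      · exact tL r j hr le_rfl rfl (by simp [lowerIn, h0])
      · exact tL r j hr le_rfl rfl (by simp [lowerIn, h0])
      · exact tM q j le_rfl rfl (by simp [middleIn, h0])
    rcases Nat.lt_or_ge p j.1 with h1 | h1
    · rcases Nat.lt_or_ge (p + q) j.1 with h2 | h2
      · rcases Nat.lt_or_ge (p + q + 1) j.1 with h3 | h3
        · refine tL (j.1 - p - q - 1) j (by omega) (by omega) rfl ?_
          rw [lowerIn, if_pos (by omega)]
          omega
        · refine tU p j hp le_rfl rfl ?_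
          rw [upperIn, if_neg (by omega)]
          omega
      · refine tM (j.1 - p - 1) j (by omega) rfl ?_
        rw [middleIn, if_pos (by omega)]
        omega
    · refine tU (j.1 - 1) j (by omega) (by omega) rfl ?_
      rw [upperIn, if_pos (by omega)]
      omega

theorem nodup_lines (p q r : ℕ) (hp : 1 ≤ p) (hr : 1 ≤ r) (x y : Bool) :
    ((lines p q r x y).flatMap ChordLine.ends).Nodup := by
  classical
  have hC : ((List.finRange (p + q + r + 1)).flatMap
      fun j => [ChordEnd.init j, ChordEnd.term j]).Nodup := by
    rw [List.nodup_flatMap]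
    refine ⟨by simp, List.Pairwise.imp ?_ (List.nodup_finRange _)⟩
    intro i j h
    simp [Function.onFun, Ne.symm h]
  have hs := List.subperm_of_subset hC
    (fun e _ => complete_lines p q r hp hr x y e)
  refine ((hs.perm_of_length_le ?_).nodup_iff).1 hC
  rw [length_lines p q r hp hr]
  simp [List.length_flatMap]
  omega

/-- The chord diagram `D(Θ(p,q,r))`. -/
def diagram (p q r : ℕ) (hp : 1 ≤ p) (hr : 1 ≤ r) (x y : Bool) :
    ChordDiagram (p + q + r + 1) where
  lines := lines p q r x y
  nodup := nodup_lines p q r hp hr x y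
  complete := complete_lines p q r hp hr x y

/-- The ribbon presentation `P(Θ(p,q,r))`; all its crossings are positive. -/
def presentation (p q r : ℕ) (hp : 1 ≤ p) (hr : 1 ≤ r) (x y : Bool) :
    RibbonPresentation (p + q + r + 1) :=
  (diagram p q r hp hr x y).ribbon fun _ => 1

/-- The first white disk of the part `Q` of `P(Θ(p,q,r))`, at the origin of its line. -/
def whiteDisk₁ (p q r : ℕ) : RibbonDisk (p + q + r + 1) := RibbonDisk.white (chord p q r 0)

/-- The second white disk of the part `Q` of `P(Θ(p,q,r))`. -/
def whiteDisk₂ (p q r : ℕ) : RibbonDisk (p + q + r + 1) := RibbonDisk.white (chord p q r 1)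

/-- The gray disk of the part `Q` of `P(Θ(p,q,r))`. -/
def grayNode (p q r : ℕ) : RibbonDisk (p + q + r + 1) := RibbonDisk.gray (chord p q r 1)

end Theta

/-! ### Disks of a presentation. -/

namespace RibbonPresentation

variable {k : ℕ}

/-! Consider the relation "the band starting at `d` crosses `d'`". In `P(Θ(p,q,r))` the gray disk
leads along the upper chords to the first lower line, which branches into the middle and the lower
chords, and these two branches end at the two white disks of `Q`. The only cycles arise because the
white disks of `Q` are attached to the gray disk.

For (a), both cycles are broken by two cross-changes. Next to the marked crossing with a white disk
of `Q`, an opposite crossing with a fresh copy of the gray node is inserted. Once the label is gone,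
both crossings can be pushed by S4 along bands without crossings to the gray node, where they cancel
by S2, and the copy is removed by S1 (`equivalent_of_cancel`). So a sign `+1` has the effect of
taking the white disk off the band (`exists_cancelingChange`). When this is done at both white disks
of `Q`, the remaining relation increases a rank, so all disks can be drawn back in order
(`equivalent_trivial`, `equivalent_trivial_resolve`).

For (b), removing the `i`-th crossing frees the `i`-th white disk. If it belongs to `Q`, nothing
remains to be done. Otherwise it is deleted with its band, which frees the next disk, and so on
until a white disk of `Q` is free (`exists_deletable`, `exists_node`). Only deletions S1 outside `Q`
are used. The argument sees only the crossings with white disks, so it applies equally to `P'`,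
whose additional crossings are with copies of the gray node. The common features of the two
presentations are collected in `HasThetaShape`. -/

theorem ext_bands {P R : RibbonPresentation k} (h : P.bands = R.bands) : P = R := by
  cases P; cases R; cases h; rfl

theorem HasDisk.mono {P R : RibbonPresentation k} {d : RibbonDisk k} (hd : P.HasDisk d)
    (h : ∀ d ∈ P.bands.map RibbonBand.tail, d ∈ R.bands.map RibbonBand.tail) : R.HasDisk d :=
  hd.imp id (h d)

theorem hasDisk_resolve {P : RibbonPresentation k} {ε : Fin k → ℤˣ} {d : RibbonDisk k} :
    (P.resolve ε).HasDisk d ↔ P.HasDisk d := by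
  simp only [HasDisk, resolve, map_tail_resolveBand]

theorem hasDisk_tail {P : RibbonPresentation k} {b : RibbonBand k} (hb : b ∈ P.bands) :
    P.HasDisk b.tail :=
  Or.inr (List.mem_map_of_mem hb)

/-- The path from the tail of the band to `D₀` must begin with this very band, since tails are
distinct. So its head lies on the path, hence is `D₀` or the tail of the next band. -/
theorem hasDisk_head {P : RibbonPresentation k} {b : RibbonBand k} (hb : b ∈ P.bands) :
    P.HasDisk b.head := by
  rcases (P.connected b hb).cases_head with h | ⟨d, ⟨a, ha, h1, rfl⟩, h2⟩
  · exact absurd h (P.base_not_tail b hb)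
  · obtain rfl := List.inj_on_of_nodup_map P.tails_nodup ha hb h1
    rcases h2.cases_head with h | ⟨d, ⟨c, hc, h3, -⟩, -⟩
    · exact Or.inl h
    · exact h3 ▸ hasDisk_tail hc

/-! ### New presentations from old ones -/

/-- A disk that no band intersects and to which no further band is attached can be deleted. -/
theorem exists_delete (P : RibbonPresentation k) {l₁ l₂ : List (RibbonBand k)} {b : RibbonBand k}
    (hP : P.bands = l₁ ++ b :: l₂) (hc : ∀ a ∈ P.bands, ∀ c ∈ a.word, c.disk ≠ b.tail)
    (hh : ∀ a ∈ P.bands, a.head ≠ b.tail) :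
    ∃ R : RibbonPresentation k, R.bands = l₁ ++ l₂ ∧ MoveS1 P R := by
  have hsub : (l₁ ++ l₂).Sublist P.bands := by
    rw [hP]
    exact (List.Sublist.refl _).append (List.sublist_cons_self _ _)
  have hmem : ∀ a ∈ P.bands, a.tail ≠ b.tail → a ∈ l₁ ++ l₂ := by
    intro a ha hne
    rw [hP] at ha
    simp only [List.mem_append, List.mem_cons] at ha ⊢
    rcases ha with ha | rfl | ha
    · exact Or.inl ha
    · exact absurd rfl hne
    · exact Or.inr ha
  have hne : ∀ a ∈ l₁ ++ l₂, a.tail ≠ b.tail := by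
    have := P.tails_nodup
    rw [hP, List.map_append, List.map_cons, List.nodup_middle] at this
    rw [List.nodup_cons, ← List.map_append] at this
    intro a ha h
    exact this.1 (h ▸ List.mem_map_of_mem ha)
  -- No band ends at the deleted disk, so a path to `D₀` that starts elsewhere never visits it.
  have hconn : ∀ d, Relation.ReflTransGen (RibbonStep P.bands) d RibbonDisk.base →
      d ≠ b.tail → Relation.ReflTransGen (RibbonStep (l₁ ++ l₂)) d RibbonDisk.base := by
    intro d hd
    induction hd using Relation.ReflTransGen.head_induction_on with
    | refl => exact fun _ => Relation.ReflTransGen.refl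
    | head h _ ih =>
      obtain ⟨a, ha, rfl, rfl⟩ := h
      exact fun h => Relation.ReflTransGen.head ⟨a, hmem a ha h, rfl, rfl⟩ (ih (hh a ha))
  refine ⟨⟨l₁ ++ l₂, P.tails_nodup.sublist (hsub.map _),
    fun a ha => P.base_not_tail a (hsub.subset ha),
    fun a ha => hconn _ (P.connected a (hsub.subset ha)) (hne a ha), ?_⟩, rfl,
    l₁, b, l₂, hP, rfl, ⟨hasDisk_tail (by simp [hP]), hc⟩, hh⟩
  intro a ha c hca
  refine (P.crossing_mem a (hsub.subset ha) c hca).imp id fun h => ?_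
  obtain ⟨a', ha', h⟩ := List.mem_map.1 h
  rw [← h]
  exact List.mem_map_of_mem (hmem a' ha' (h ▸ hc a (hsub.subset ha) c hca))

/-- The crossings along one band can be changed at will. -/
theorem exists_rewrite (P : RibbonPresentation k) {l₁ l₂ : List (RibbonBand k)}
    {t h : RibbonDisk k} {w : List (RibbonCrossing k)} (w' : List (RibbonCrossing k))
    (hP : P.bands = l₁ ++ ⟨t, h, w⟩ :: l₂) (hw : ∀ c ∈ w', P.HasDisk c.disk) :
    ∃ R : RibbonPresentation k, R.bands = l₁ ++ ⟨t, h, w'⟩ :: l₂ := by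
  have htail : (l₁ ++ ⟨t, h, w'⟩ :: l₂).map RibbonBand.tail = P.bands.map RibbonBand.tail := by
    simp [hP]
  have hstep : ∀ b ∈ l₁ ++ ⟨t, h, w'⟩ :: l₂, ∃ a ∈ P.bands, a.tail = b.tail := by
    intro b hb
    have := List.mem_map_of_mem (f := RibbonBand.tail) hb
    rw [htail] at this
    simpa using this
  refine ⟨⟨l₁ ++ ⟨t, h, w'⟩ :: l₂, htail ▸ P.tails_nodup, ?_, ?_, ?_⟩, rfl⟩
  · intro b hb
    obtain ⟨a, ha, hab⟩ := hstep b hb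
    exact hab ▸ P.base_not_tail a ha
  · intro b hb
    obtain ⟨a, ha, hab⟩ := hstep b hb
    rw [← hab]
    refine RibbonStep.mono ?_ (P.connected a ha)
    rintro d e ⟨a, ha, rfl, rfl⟩
    rw [hP] at ha
    simp only [List.mem_append, List.mem_cons] at ha
    rcases ha with ha | rfl | ha
    · exact ⟨a, by simp [ha], rfl, rfl⟩
    · exact ⟨⟨t, h, w'⟩, by simp, rfl, rfl⟩
    · exact ⟨a, by simp [ha], rfl, rfl⟩
  · intro b hb c hc
    rw [htail]
    simp only [List.mem_append, List.mem_cons] at hb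
    rcases hb with hb | rfl | hb
    · exact P.crossing_mem b (by simp [hP, hb]) c hc
    · exact hw c hc
    · exact P.crossing_mem b (by simp [hP, hb]) c hc

/-- A copy of a disk can be added. -/
theorem exists_copy (P : RibbonPresentation k) {d n : RibbonDisk k} (hd : ¬ P.HasDisk d)
    (hn : P.HasDisk n) :
    ∃ R : RibbonPresentation k, R.bands = P.bands ++ [⟨d, n, []⟩] := by
  have hconn : ∀ e, Relation.ReflTransGen (RibbonStep P.bands) e RibbonDisk.base →
      Relation.ReflTransGen (RibbonStep (P.bands ++ [⟨d, n, []⟩])) e RibbonDisk.base := by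
    intro e
    refine RibbonStep.mono ?_
    rintro d e ⟨a, ha, h⟩
    exact ⟨a, List.mem_append_left _ ha, h⟩
  have hn' : Relation.ReflTransGen (RibbonStep P.bands) n RibbonDisk.base := by
    rcases hn with rfl | hn
    · exact Relation.ReflTransGen.refl
    · obtain ⟨a, ha, rfl⟩ := List.mem_map.1 hn
      exact P.connected a ha
  refine ⟨⟨P.bands ++ [⟨d, n, []⟩], ?_, ?_, ?_, ?_⟩, rfl⟩
  · rw [List.map_append]
    refine P.tails_nodup.append (by simp) ?_
    rw [List.disjoint_right]
    intro a ha h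
    simp only [List.map_cons, List.map_nil, List.mem_singleton] at ha
    exact hd (Or.inr (ha ▸ h))
  · intro b hb
    rcases List.mem_append.1 hb with hb | hb
    · exact P.base_not_tail b hb
    · rw [List.mem_singleton.1 hb]
      exact fun h => hd (Or.inl h)
  · intro b hb
    rcases List.mem_append.1 hb with hb | hb
    · exact hconn _ (P.connected b hb)
    · rw [List.mem_singleton.1 hb]
      exact Relation.ReflTransGen.head ⟨⟨d, n, []⟩, by simp, rfl, rfl⟩ (hconn n hn')
  · intro b hb c hc
    rcases List.mem_append.1 hb with hb | hb
    · refine (P.crossing_mem b hb c hc).imp id fun h => ?_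
      rw [List.map_append]
      exact List.mem_append_left _ h
    · rw [List.mem_singleton.1 hb] at hc
      simp at hc

/-- There are infinitely many spare names and finitely many disks. -/
theorem exists_extra (P : RibbonPresentation k) : ∃ n, ¬ P.HasDisk (RibbonDisk.extra n) := by
  have hinj : Function.Injective (RibbonDisk.extra : ℕ → RibbonDisk k) := by
    intro a b h
    cases h
    rfl
  obtain ⟨_, ⟨n, rfl⟩, hn⟩ := (Set.infinite_range_of_injective hinj).exists_notMem_finite
    (List.finite_toSet (P.bands.map RibbonBand.tail))
  exact ⟨n, by rintro (h | h) <;> [simp at h; exact hn h]⟩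

/-! ### Deleting disks one after the other -/

/-- `R` arises from `P` by deleting bands whose tails satisfy `S`. -/
def DeletesFrom (P : RibbonPresentation k) (S : RibbonDisk k → Prop)
    (R : RibbonPresentation k) : Prop :=
  R.bands ⊆ P.bands ∧ ∀ b ∈ P.bands, ¬ S b.tail → b ∈ R.bands

/-- The hypothesis says that only disks of `S` of smaller rank obstruct the deletion of a disk of
`S`. Deleting in order of increasing rank therefore never gets stuck. The chain of moves records
that bands outside `S` survive at every stage, which is what allows `Q` to be tracked. -/
theorem exists_deletion (S : RibbonDisk k → Prop) (f : RibbonDisk k → ℕ)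
    (P : RibbonPresentation k)
    (H : ∀ b ∈ P.bands, ∀ d, S d → ((∃ c ∈ b.word, c.disk = d) ∨ b.head = d) →
      S b.tail ∧ f b.tail < f d) :
    ∃ R : RibbonPresentation k, (∀ b ∈ R.bands, ¬ S b.tail) ∧ P.DeletesFrom S R ∧
      Relation.ReflTransGen
        (fun A B => MoveS1 A B ∧ P.DeletesFrom S A ∧ P.DeletesFrom S B) P R := by
  obtain ⟨n, hn⟩ : ∃ n, P.bands.length = n := ⟨_, rfl⟩
  induction n generalizing P with
  | zero =>
    rw [List.length_eq_zero_iff] at hn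
    exact ⟨P, by simp [hn], ⟨List.Subset.refl _, fun _ h _ => h⟩, Relation.ReflTransGen.refl⟩
  | succ n ih =>
    by_cases hS : ∃ b, b ∈ P.bands ∧ S b.tail
    -- A disk of minimal rank in `S` is neither crossed nor has a band attached to it, so S1
    -- applies.
    · obtain ⟨b, ⟨hb, hbS⟩, hmin⟩ := (measure fun b : RibbonBand k => f b.tail).wf.has_min
        {b | b ∈ P.bands ∧ S b.tail} hS
      have hno : ∀ a ∈ P.bands,
          ¬ ((∃ c ∈ a.word, c.disk = b.tail) ∨ a.head = b.tail) := by
        intro a ha h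
        obtain ⟨h1, h2⟩ := H a ha _ hbS h
        exact hmin a ⟨ha, h1⟩ h2
      obtain ⟨l₁, l₂, hP⟩ := List.append_of_mem hb
      obtain ⟨A, hA, hmove⟩ := P.exists_delete hP
        (fun a ha c hc h => hno a ha (Or.inl ⟨c, hc, h⟩)) fun a ha h => hno a ha (Or.inr h)
      have hsub : A.bands ⊆ P.bands := by
        intro a ha
        rw [hA, List.mem_append] at ha
        rcases ha with ha | ha <;> simp [hP, ha]
      have hPA : P.DeletesFrom S A := by
        refine ⟨hsub, fun a ha haS => ?_⟩
        rw [hP, List.mem_append, List.mem_cons] at ha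
        rw [hA, List.mem_append]
        rcases ha with ha | rfl | ha
        · exact Or.inl ha
        · exact absurd hbS haS
        · exact Or.inr ha
      have htrans : ∀ B, A.DeletesFrom S B → P.DeletesFrom S B := fun B hB =>
        ⟨List.Subset.trans hB.1 hsub, fun b hb hbS => hB.2 b (hPA.2 b hb hbS) hbS⟩
      obtain ⟨R, h1, h2, h3⟩ := ih A (fun b hb => H b (hsub hb)) (by
        rw [hP] at hn
        rw [hA]
        simp only [List.length_append, List.length_cons] at hn ⊢
        omega)
      refine ⟨R, h1, htrans R h2, Relation.ReflTransGen.head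
        ⟨hmove, ⟨List.Subset.refl _, fun _ h _ => h⟩, hPA⟩ (Relation.ReflTransGen.mono ?_ _ _ h3)⟩
      rintro B C ⟨h, hB, hC⟩
      exact ⟨h, htrans B hB, htrans C hC⟩
    · exact ⟨P, fun b hb h => hS ⟨b, hb, h⟩, ⟨List.Subset.refl _, fun _ h _ => h⟩,
        Relation.ReflTransGen.refl⟩

/-- A presentation is trivial if the disks can be ranked so that each band only runs through, and
only ends at, disks of higher rank than the one it starts at, or `D₀`. -/
theorem equivalent_trivial (f : RibbonDisk k → ℕ) (P : RibbonPresentation k)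
    (H : ∀ b ∈ P.bands, ∀ d, d ≠ RibbonDisk.base →
      ((∃ c ∈ b.word, c.disk = d) ∨ b.head = d) → f b.tail < f d) :
    P.Equivalent (trivialPresentation k) := by
  obtain ⟨R, h1, -, h3⟩ := P.exists_deletion (· ≠ RibbonDisk.base) f
    fun b hb d hd h => ⟨P.base_not_tail b hb, H b hb d hd h⟩
  have hR : R = trivialPresentation k :=
    ext_bands (List.eq_nil_iff_forall_not_mem.2 fun b hb => h1 b hb (R.base_not_tail b hb))
  rw [← hR]
  clear h1 hR H
  induction h3 with
  | refl => exact Relation.EqvGen.refl _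
  | tail _ h ih => exact Relation.EqvGen.trans _ _ _ ih (Relation.EqvGen.rel _ _ (Or.inl h.1))

/-- Deleting disks outside the part `Q`. -/
theorem exists_deletion_keepingQ {w₁ w₂ n : RibbonDisk k} (S : RibbonDisk k → Prop)
    (f : RibbonDisk k → ℕ) (P : RibbonPresentation k) (hQ : P.HasPartQ w₁ w₂ n)
    (hw₁ : ¬ S w₁) (hw₂ : ¬ S w₂) (hn : ¬ S n)
    (H : ∀ b ∈ P.bands, ∀ d, S d → ((∃ c ∈ b.word, c.disk = d) ∨ b.head = d) →
      S b.tail ∧ f b.tail < f d) :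
    ∃ R : RibbonPresentation k, R.bands ⊆ P.bands ∧ (∀ b ∈ R.bands, ¬ S b.tail) ∧
      R.HasPartQ w₁ w₂ n ∧ EquivalentKeepingQ w₁ w₂ n P R := by
  obtain ⟨R, h1, h2, h3⟩ := P.exists_deletion S f H
  have key : ∀ R, P.DeletesFrom S R → R.HasPartQ w₁ w₂ n := by
    rintro R ⟨hs, hk⟩
    refine ⟨hk _ hQ.band₁ hw₁, hk _ hQ.band₂ hw₂, fun b hb => hQ.only₁ b (hs hb),
      fun b hb => hQ.only₂ b (hs hb), hQ.isNode.1.imp id fun h => ?_,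
      fun b hb => hQ.isNode.2 b (hs hb)⟩
    obtain ⟨b, hb, rfl⟩ := List.mem_map.1 h
    exact List.mem_map_of_mem (hk b hb hn)
  refine ⟨R, h2.1, h1, key R h2, ?_⟩
  clear h1 h2
  induction h3 with
  | refl => exact Relation.EqvGen.refl _
  | tail _ h ih =>
    exact Relation.EqvGen.trans _ _ _ ih
      (Relation.EqvGen.rel _ _ ⟨key _ h.2.1, key _ h.2.2, Or.inl h.1⟩)

/-! ### Cancelling a marked crossing by a cross-change -/

/-- The labels `⋆` in the order in which they are met. -/
def stars (P : RibbonPresentation k) : List (Fin k) :=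
  (P.bands.flatMap RibbonBand.word).filterMap RibbonCrossing.star

theorem resolveBand_congr {ε ε' : Fin k → ℤˣ} {b : RibbonBand k}
    (h : ∀ c ∈ b.word, ∀ i, c.star = some i → ε i = ε' i) :
    resolveBand ε b = resolveBand ε' b := by
  simp only [resolveBand, RibbonBand.mk.injEq, true_and]
  refine List.filterMap_congr fun c hc => ?_
  unfold resolveCrossing
  split
  · rfl
  · rename_i i hi
    rw [h c hc i hi]

theorem Equivalent.trans {P R T : RibbonPresentation k} (h₁ : P.Equivalent R)
    (h₂ : R.Equivalent T) : P.Equivalent T :=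
  Relation.EqvGen.trans _ _ _ h₁ h₂

/-- Both `d` and `e` hang on `n` by bands without crossings, so S4 replaces a crossing with either
by a crossing with `n` of the same sign. The two opposite crossings with `n` cancel, and `e` is then
free to be deleted. The push along the band of `d` is legitimate for `Equivalent`; for a white disk
of `Q` it is forbidden in `EquivalentKeepingQ`. -/
theorem equivalent_of_cancel {P R : RibbonPresentation k} {l₁ l₂ : List (RibbonBand k)}
    {t h d e n : RibbonDisk k} {u v : List (RibbonCrossing k)} {s : ℤˣ}
    (hd : (⟨d, n, []⟩ : RibbonBand k) ∈ l₁ ++ l₂)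
    (hP : P.bands = l₁ ++ ⟨t, h, u ++ ⟨d, s, none⟩ :: ⟨e, -s, none⟩ :: v⟩ :: l₂ ++ [⟨e, n, []⟩])
    (hR : R.bands = l₁ ++ ⟨t, h, u ++ v⟩ :: l₂)
    (he : ¬ R.HasDisk e) (hne : n ≠ e) (hn : R.HasDisk n) : P.Equivalent R := by
  have hP0 : P.bands = l₁ ++ ⟨t, h, u ++ ⟨d, s, none⟩ :: ⟨e, -s, none⟩ :: v⟩ ::
      (l₂ ++ [⟨e, n, []⟩]) := by simp [hP]
  have hRP : ∀ {c}, R.HasDisk c → P.HasDisk c := by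
    intro c hc
    refine hc.mono fun c hc => ?_
    simp only [hR, hP0, List.map_append, List.map_cons, List.mem_append, List.mem_cons] at hc ⊢
    tauto
  have hcr : ∀ b ∈ R.bands, ∀ c ∈ b.word, R.HasDisk c.disk := R.crossing_mem
  have huv : ∀ c ∈ u ++ v, R.HasDisk c.disk := hcr ⟨t, h, u ++ v⟩ (by simp [hR])
  have heP : P.HasDisk e := hasDisk_tail (b := ⟨e, n, []⟩) (by simp [hP])
  obtain ⟨A, hA⟩ := P.exists_rewrite (u ++ ⟨n, s, none⟩ :: ⟨e, -s, none⟩ :: v) hP0 (by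
    intro c hc
    simp only [List.mem_append, List.mem_cons] at hc
    rcases hc with hc | rfl | rfl | hc
    · exact hRP (huv c (by simp [hc]))
    · exact hRP hn
    · exact heP
    · exact hRP (huv c (by simp [hc])))
  obtain ⟨B, hB⟩ := P.exists_rewrite (u ++ ⟨n, s, none⟩ :: ⟨n, -s, none⟩ :: v) hP0 (by
    intro c hc
    simp only [List.mem_append, List.mem_cons] at hc
    rcases hc with hc | rfl | rfl | hc
    · exact hRP (huv c (by simp [hc]))
    · exact hRP hn
    · exact hRP hn
    · exact hRP (huv c (by simp [hc])))
  obtain ⟨C, hC⟩ := P.exists_rewrite (u ++ v) hP0 fun c hc => hRP (huv c hc)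
  -- S4 at `d` with `β = []`: no conjugating crossings appear.
  have hPA : P.Equivalent A := by
    refine Relation.EqvGen.rel _ _ (Or.inr (Or.inr (Or.inl ⟨d, t, h, u, _, s, l₁ ++ (l₂ ++ [⟨e, n, []⟩]), n, [], ?_,
      by simp, l₁, _, rfl, hP0, ?_⟩)))
    · simp only [List.mem_append] at hd ⊢
      tauto
    · simp [hA, reverseWord]
  -- The same push at `e`, past the crossing with `n` just created.
  have hAB : A.Equivalent B := by
    refine Relation.EqvGen.rel _ _ (Or.inr (Or.inr (Or.inl ⟨e, t, h, u ++ [⟨n, s, none⟩], v, -s,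
      l₁ ++ (l₂ ++ [⟨e, n, []⟩]), n, [], ?_, by simp, l₁, _, rfl, by simp [hA], ?_⟩)))
    · simp
    · simp [hB, reverseWord]
  have hBC : B.Equivalent C :=
    Relation.EqvGen.rel _ _ (Or.inr (Or.inl ⟨t, h, u, v, n, s, _, l₁, _, rfl, hB, hC⟩))
  have hC' : C.bands = (l₁ ++ ⟨t, h, u ++ v⟩ :: l₂) ++ ⟨e, n, []⟩ :: [] := by simp [hC]
  have hCmem : ∀ b ∈ C.bands, b ∈ R.bands ∨ b = ⟨e, n, []⟩ := by
    intro b hb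
    rw [hC', List.mem_append, List.mem_singleton] at hb
    rwa [hR]
  have hCR : C.Equivalent R := by
    refine Relation.EqvGen.rel _ _ (Or.inl ⟨_, _, [], hC', by simp [hR],
      ⟨hasDisk_tail (b := ⟨e, n, []⟩) (by simp [hC']), ?_⟩, ?_⟩)
    · intro b hb c hc h
      rcases hCmem b hb with hb | rfl
      · exact he (by simpa [h] using hcr b hb c hc)
      · simp at hc
    · intro b hb h
      rcases hCmem b hb with hb | rfl
      · exact he (by simpa [h] using hasDisk_head hb)
      · exact hne h
  exact hPA.trans (hAB.trans (hBC.trans hCR))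

end RibbonPresentation

namespace RibbonPresentation

variable {k : ℕ}

/-- A cross-change at `n` next to the `j`-th marked crossing, made with the white disk of the `j`-th
chord, which is joined to `n` by a band without crossings: the new crossing is with the fresh disk
`e` and has the opposite sign. -/
structure CancelingChange (n : RibbonDisk k) (j : Fin k) (e : RibbonDisk k)
    (P R : RibbonPresentation k) : Prop where
  crossChange : CrossChange n P R
  equivalent : ∀ ε : Fin k → ℤˣ, ε j = 1 →
    (R.resolve ε).Equivalent (P.resolve (Function.update ε j (-1)))
  stars_eq : R.stars = P.stars
  mem_of_mem : ∀ b ∈ P.bands, b.word = [] → b ∈ R.bands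
  exists_crossing : ∀ b ∈ P.bands, ∀ c ∈ b.word, ∃ a ∈ R.bands, c ∈ a.word
  exists_of_mem : ∀ b ∈ R.bands, b = ⟨e, n, []⟩ ∨ ∃ a ∈ P.bands, a.tail = b.tail ∧
    a.head = b.head ∧ ∀ c ∈ b.word, c ∈ a.word ∨ c.disk = e ∧ c.star = none

/-- The copy `e` of `n` is inserted immediately after the crossing labelled `j`, with sign `-s`.
Distinctness of the labels is essential: changing `ε j` must affect no other crossing. -/
theorem exists_cancelingChange (P : RibbonPresentation k) {n : RibbonDisk k} {j : Fin k}
    {e : RibbonDisk k} (hn : P.IsNode n) (he : ¬ P.HasDisk e) (hst : P.stars.Nodup)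
    (hj : (⟨RibbonDisk.white j, n, []⟩ : RibbonBand k) ∈ P.bands)
    (hc : ∃ b ∈ P.bands, ∃ c ∈ b.word, c.disk = RibbonDisk.white j ∧ c.star = some j) :
    ∃ R, CancelingChange n j e P R := by
  obtain ⟨⟨t, h, w⟩, hb, ⟨d, s, m⟩, hcw, hd, hm⟩ := hc
  simp only at hcw hd hm
  subst hd hm
  obtain ⟨u, v, rfl⟩ := List.append_of_mem hcw
  obtain ⟨l₁, l₂, hP⟩ := List.append_of_mem hb
  have hne : n ≠ e := fun h => he (h ▸ hn.1)
  obtain ⟨A, hA⟩ := P.exists_copy he hn.1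
  have hPA : ∀ {d}, P.HasDisk d → A.HasDisk d := by
    intro d hd
    refine hd.mono fun d hd => ?_
    rw [hA, List.map_append]
    exact List.mem_append_left _ hd
  have hA' : A.bands = l₁ ++ ⟨t, h, u ++ ⟨RibbonDisk.white j, s, some j⟩ :: v⟩ ::
      (l₂ ++ [⟨e, n, []⟩]) := by simp [hA, hP]
  obtain ⟨R, hR⟩ := A.exists_rewrite
    (u ++ ⟨RibbonDisk.white j, s, some j⟩ :: ⟨e, -s, none⟩ :: v) hA' (by
      have hP' : ∀ c ∈ u ++ ⟨RibbonDisk.white j, s, some j⟩ :: v, A.HasDisk c.disk :=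
        fun c hc => hPA (P.crossing_mem _ hb c hc)
      intro c hc
      simp only [List.mem_append, List.mem_cons] at hc hP'
      rcases hc with hc | rfl | rfl | hc
      · exact hP' c (Or.inl hc)
      · exact hP' _ (Or.inr (Or.inl rfl))
      · exact hasDisk_tail (b := ⟨e, n, []⟩) (by simp [hA])
      · exact hP' c (Or.inr (Or.inr hc)))
  -- The label `j` occurs once in the list of labels, so it is absent from everything around the
  -- chosen crossing.
  have hst' : ∀ c : RibbonCrossing k, c.star = some j →
      c ∉ l₁.flatMap RibbonBand.word ∧ c ∉ l₂.flatMap RibbonBand.word ∧ c ∉ u ∧ c ∉ v := by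
    intro c hcj
    simp only [stars, hP, List.flatMap_append, List.flatMap_cons, List.filterMap_append,
      List.filterMap_cons] at hst
    rw [List.append_assoc, List.cons_append, ← List.append_assoc, List.nodup_middle,
      List.nodup_cons] at hst
    have hno := hst.1
    simp only [List.mem_append, not_or, List.mem_filterMap, not_exists, not_and] at hno
    exact ⟨fun h => hno.1.1 c h hcj, fun h => hno.2.2 c h hcj, fun h => hno.1.2 c h hcj,
      fun h => hno.2.1 c h hcj⟩
  refine ⟨R, ⟨⟨hn, e, l₁, t, h, u ++ [⟨RibbonDisk.white j, s, some j⟩], v, -s, l₂, he,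
    by simp [hP], by simp [hR]⟩, ?_, ?_, ?_, ?_, ?_⟩⟩
  · intro ε hε
    -- Away from the label `j`, the signs `ε` and their update at `j` resolve alike.
    have hup : ∀ c : RibbonCrossing k, c.star ≠ some j → ∀ i, c.star = some i →
        ε i = Function.update ε j (-1) i := by
      intro c hc i hi
      rw [Function.update_of_ne]
      rintro rfl
      exact hc hi
    have hbup : ∀ b : RibbonBand k, (∀ c ∈ b.word, c.star ≠ some j) →
        resolveBand ε b = resolveBand (Function.update ε j (-1)) b :=
      fun b hb => resolveBand_congr fun c hc => hup c (hb c hc)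
    have hl₁ : l₁.map (resolveBand ε) = l₁.map (resolveBand (Function.update ε j (-1))) :=
      List.map_congr_left fun b hb => hbup b fun c hc h =>
        (hst' c h).1 (List.mem_flatMap.2 ⟨b, hb, hc⟩)
    have hl₂ : l₂.map (resolveBand ε) = l₂.map (resolveBand (Function.update ε j (-1))) :=
      List.map_congr_left fun b hb => hbup b fun c hc h =>
        (hst' c h).2.1 (List.mem_flatMap.2 ⟨b, hb, hc⟩)
    have huv := hbup ⟨t, h, u ++ v⟩ fun c hc h =>
      (List.mem_append.1 hc).elim (hst' c h).2.2.1 (hst' c h).2.2.2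
    simp only [resolveBand, RibbonBand.mk.injEq, true_and, List.filterMap_append] at huv
    refine equivalent_of_cancel (l₁ := l₁.map (resolveBand ε)) (l₂ := l₂.map (resolveBand ε))
      (t := t) (h := h) (d := RibbonDisk.white j) (e := e) (n := n) (s := s)
      (u := u.filterMap (resolveCrossing ε)) (v := v.filterMap (resolveCrossing ε)) ?_ ?_ ?_ ?_ hne
      ?_
    · rw [hP, List.mem_append, List.mem_cons] at hj
      rw [List.mem_append]
      rcases hj with hj | hj | hj
      · exact Or.inl (List.mem_map.2 ⟨_, hj, by simp [resolveBand]⟩)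
      · simp at hj
      · exact Or.inr (List.mem_map.2 ⟨_, hj, by simp [resolveBand]⟩)
    · simp [resolve, hR, resolveBand, resolveCrossing, hε]
    · simp only [resolve, hP, List.map_append, List.map_cons, hl₁, hl₂]
      simp [resolveBand, huv, resolveCrossing]
    · rwa [hasDisk_resolve]
    · rw [hasDisk_resolve]
      exact hn.1
  · simp [stars, hP, hR]
  · intro b hb hw
    rw [hP, List.mem_append, List.mem_cons] at hb
    rw [hR]
    rcases hb with hb | rfl | hb
    · simp [hb]
    · simp at hw
    · simp [hb]
  · intro b hb c hc
    rw [hP, List.mem_append, List.mem_cons] at hb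
    rw [hR]
    rcases hb with hb | rfl | hb
    · exact ⟨b, by simp [hb], hc⟩
    · refine ⟨_, List.mem_append_right _ List.mem_cons_self, ?_⟩
      simp only [List.mem_append, List.mem_cons] at hc ⊢
      tauto
    · exact ⟨b, by simp [hb], hc⟩
  · intro b hb
    rw [hR] at hb
    simp only [List.mem_append, List.mem_cons, List.not_mem_nil, or_false] at hb
    have hself : b ∈ P.bands → ∃ a ∈ P.bands, a.tail = b.tail ∧ a.head = b.head ∧
        ∀ c ∈ b.word, c ∈ a.word ∨ c.disk = e ∧ c.star = none :=
      fun h => ⟨b, h, rfl, rfl, fun c hc => Or.inl hc⟩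
    rcases hb with hb | rfl | hb | hb
    · exact Or.inr (hself (by simp [hP, hb]))
    · refine Or.inr ⟨⟨t, h, u ++ ⟨RibbonDisk.white j, s, some j⟩ :: v⟩, hb, rfl, rfl, ?_⟩
      intro c hc
      simp only [List.mem_append, List.mem_cons] at hc ⊢
      rcases hc with hc | rfl | rfl | hc
      · exact Or.inl (Or.inl hc)
      · exact Or.inl (Or.inr (Or.inl rfl))
      · exact Or.inr ⟨rfl, rfl⟩
      · exact Or.inl (Or.inr (Or.inr hc))
    · exact Or.inr (hself (by simp [hP, hb]))
    · exact Or.inl hb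

end RibbonPresentation

/-! ### The labelled crossings of the ribbon presentation of a chord diagram. -/

namespace ChordDiagram

variable {k : ℕ}

/-- The labelled crossing given by a terminal point of a chord. -/
def termCrossing (sgn : Fin k → ℤˣ) : ChordEnd k → Option (RibbonCrossing k)
  | ChordEnd.init _ => none
  | ChordEnd.term j => some ⟨RibbonDisk.white j, sgn j, some j⟩

theorem words_lineBands (sgn : Fin k → ℤˣ) (es : List (ChordEnd k)) :
    ∀ (cur : RibbonDisk k) (w : List (RibbonCrossing k)),
      (lineBands sgn cur w es).flatMap RibbonBand.word = w ++ es.filterMap (termCrossing sgn) := by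
  induction es with
  | nil => intro cur w; simp [lineBands]
  | cons e es ih =>
    intro cur w
    cases e with
    | init j => simp [lineBands, termCrossing, ih, List.filterMap_cons]
    | term j => simp [lineBands, termCrossing, ih]

theorem words_ribbon (D : ChordDiagram k) (sgn : Fin k → ℤˣ) :
    (D.ribbon sgn).bands.flatMap RibbonBand.word =
      (D.lines.flatMap ChordLine.ends).filterMap (termCrossing sgn) := by
  have h : ∀ L : List (ChordLine k),
      (L.flatMap fun l => lineBands sgn (RibbonDisk.white l.origin) [] l.rest).flatMap
        RibbonBand.word = (L.flatMap ChordLine.ends).filterMap (termCrossing sgn) := by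
    intro L
    induction L with
    | nil => rfl
    | cons l L ih =>
      rw [List.flatMap_cons, List.flatMap_append, List.flatMap_cons, List.filterMap_append, ih,
        words_lineBands]
      simp [ChordLine.ends, termCrossing, List.filterMap_cons]
  exact h D.lines

/-- Labels correspond to terminal points of chords, and each of these occurs once in the diagram. -/
theorem stars_ribbon_nodup (D : ChordDiagram k) (sgn : Fin k → ℤˣ) :
    (D.ribbon sgn).stars.Nodup := by
  rw [RibbonPresentation.stars, words_ribbon, List.filterMap_filterMap]
  refine D.nodup.filterMap ?_
  rintro (i | i) (j | j) a <;> simp [termCrossing]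
  rintro rfl rfl
  rfl

theorem exists_crossing_ribbon (D : ChordDiagram k) (sgn : Fin k → ℤˣ) (j : Fin k) :
    ∃ b ∈ (D.ribbon sgn).bands, ∃ c ∈ b.word, c.disk = RibbonDisk.white j ∧ c.star = some j := by
  have h : (⟨RibbonDisk.white j, sgn j, some j⟩ : RibbonCrossing k) ∈
      (D.ribbon sgn).bands.flatMap RibbonBand.word := by
    rw [words_ribbon]
    exact List.mem_filterMap.2 ⟨ChordEnd.term j, D.complete _, rfl⟩
  obtain ⟨b, hb, hc⟩ := List.mem_flatMap.1 h
  exact ⟨b, hb, _, hc, rfl, rfl⟩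

end ChordDiagram

/-! ### Bands, crossings and the part `Q` of `P(Θ(p,q,r))`. -/

namespace Theta

open RibbonPresentation

variable {p q r : ℕ}

theorem val_chord {n : ℕ} (h : n < p + q + r + 1) : (chord p q r n).1 = n := by
  simp [chord, Fin.ofNat, Nat.mod_eq_of_lt h]

/-- In `P(Θ(p,q,r))`, the band that starts at the disk `d` and ends at `D₀` crosses the white disk
of the `j`-th chord. -/
def Crosses (p q r : ℕ) (x : Bool) (d : RibbonDisk (p + q + r + 1)) (j : ℕ) : Prop :=
  (d = grayNode p q r ∧ j = upperIn p q 1) ∨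
    ∃ m : Fin (p + q + r + 1), d = RibbonDisk.white m ∧
      (2 ≤ m.1 ∧ m.1 ≤ p ∧ j = upperIn p q m ∨
        p < m.1 ∧ m.1 ≤ p + q ∧ j = middleIn p q x (m - p) ∨
        m.1 = p + q + 1 ∧ j = middleIn p q x 0 ∨
        p + q < m.1 ∧ j = lowerIn p q r x (m - p - q))

theorem upperIn_lt (hr : 1 ≤ r) {i : ℕ} : upperIn p q i < p + q + r + 1 := by
  unfold upperIn
  split <;> omega

theorem middleIn_lt (hp : 1 ≤ p) (x : Bool) {i : ℕ} : middleIn p q x i < p + q + r + 1 := by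
  unfold middleIn
  split
  · omega
  · split <;> omega

theorem lowerIn_lt (hp : 1 ≤ p) (x : Bool) {i : ℕ} : lowerIn p q r x i < p + q + r + 1 := by
  unfold lowerIn
  split
  · omega
  · split <;> omega

/-- This is the only passage from the list of lines to bands and crossings; later arguments use
`Crosses` and arithmetic of chord numbers. -/
theorem mem_bands_presentation (hp : 1 ≤ p) (hr : 1 ≤ r) (x y : Bool)
    {b : RibbonBand (p + q + r + 1)} (hb : b ∈ (presentation p q r hp hr x y).bands) :
    (b = ⟨whiteDisk₁ p q r, grayNode p q r, []⟩ ∨ b = ⟨whiteDisk₂ p q r, grayNode p q r, []⟩) ∨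
      b.head = RibbonDisk.base ∧ ∀ c ∈ b.word, ∃ j : Fin (p + q + r + 1),
        c = ⟨RibbonDisk.white j, 1, some j⟩ ∧ Crosses p q r x b.tail j := by
  change b ∈ (lines p q r x y).flatMap
    (fun l => ChordDiagram.lineBands (fun _ => 1) (RibbonDisk.white l.origin) [] l.rest) at hb
  obtain ⟨l, hl, hb⟩ := List.mem_flatMap.1 hb
  have hord : ∀ out inc, l = ordinaryLine p q r out inc →
      Crosses p q r x (RibbonDisk.white (chord p q r out)) (chord p q r inc) →
      b.head = RibbonDisk.base ∧ ∀ c ∈ b.word, ∃ j : Fin (p + q + r + 1),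
        c = ⟨RibbonDisk.white j, 1, some j⟩ ∧ Crosses p q r x b.tail j := by
    rintro out inc rfl hc
    simp only [ordinaryLine, ChordDiagram.lineBands, List.mem_singleton] at hb
    subst hb
    simp only [List.nil_append, List.mem_singleton, forall_eq, true_and]
    exact ⟨_, rfl, hc⟩
  simp only [lines, List.cons_append, List.mem_cons, List.mem_append, List.mem_map,
    List.mem_range'_1, List.append_assoc] at hl
  rcases hl with rfl | ⟨i, hi, rfl⟩ | ⟨i, hi, rfl⟩ | rfl | ⟨i, hi, rfl⟩
  · simp only [firstUpperLine, ChordDiagram.lineBands, List.mem_cons, List.not_mem_nil,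
      or_false] at hb
    rcases hb with rfl | rfl | rfl
    · exact Or.inl (Or.inl rfl)
    · exact Or.inl (Or.inr rfl)
    · refine Or.inr ⟨rfl, ?_⟩
      simp only [List.nil_append, List.mem_singleton, forall_eq]
      exact ⟨_, rfl, Or.inl ⟨rfl, val_chord (upperIn_lt hr)⟩⟩
  · refine Or.inr (hord _ _ rfl (Or.inr ⟨_, rfl, Or.inl ?_⟩))
    rw [val_chord (upperIn_lt hr), val_chord (by omega)]
    exact ⟨by omega, by omega, rfl⟩
  · refine Or.inr (hord _ _ rfl (Or.inr ⟨_, rfl, Or.inr (Or.inl ?_)⟩))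
    rw [val_chord (middleIn_lt hp x), val_chord (by omega), Nat.add_sub_cancel_left]
    exact ⟨by omega, by omega, rfl⟩
  · have hm : Crosses p q r x (RibbonDisk.white (chord p q r (p + q + 1)))
        (chord p q r (middleIn p q x 0)) := by
      refine Or.inr ⟨_, rfl, Or.inr (Or.inr (Or.inl ?_))⟩
      rw [val_chord (middleIn_lt hp x), val_chord (by omega)]
      exact ⟨rfl, rfl⟩
    have hl : Crosses p q r x (RibbonDisk.white (chord p q r (p + q + 1)))
        (chord p q r (lowerIn p q r x 1)) := by
      refine Or.inr ⟨_, rfl, Or.inr (Or.inr (Or.inr ?_))⟩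
      rw [val_chord (lowerIn_lt hp x), val_chord (by omega)]
      refine ⟨by omega, congrArg _ (by omega)⟩
    right
    -- The two orders of the terminal points give the same crossings, so `Crosses` does not depend
    -- on `y`.
    cases y <;>
    · simp only [firstLowerLine, if_true, Bool.false_eq_true, if_false, ChordDiagram.lineBands,
        List.mem_singleton] at hb
      subst hb
      simp only [List.nil_append, List.mem_cons, List.cons_append, List.not_mem_nil, or_false,
        forall_eq_or_imp, forall_eq, true_and]
      first
        | exact ⟨⟨_, rfl, hm⟩, _, rfl, hl⟩
        | exact ⟨⟨_, rfl, hl⟩, _, rfl, hm⟩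
  · refine Or.inr (hord _ _ rfl (Or.inr ⟨_, rfl, Or.inr (Or.inr (Or.inr ?_))⟩))
    rw [val_chord (lowerIn_lt hp x), val_chord (by omega)]
    exact ⟨by omega, congrArg _ (by omega)⟩

theorem bands_Q_mem (hp : 1 ≤ p) (hr : 1 ≤ r) (x y : Bool) :
    ⟨whiteDisk₁ p q r, grayNode p q r, []⟩ ∈ (presentation p q r hp hr x y).bands ∧
    ⟨whiteDisk₂ p q r, grayNode p q r, []⟩ ∈ (presentation p q r hp hr x y).bands := by
  have h : firstUpperLine p q r ∈ lines p q r x y := by simp [lines]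
  constructor <;>
  exact List.mem_flatMap.2 ⟨_, h, by
    simp [firstUpperLine, ChordDiagram.lineBands, whiteDisk₁, whiteDisk₂, grayNode]⟩

theorem hasDisk_grayNode (hp : 1 ≤ p) (hr : 1 ≤ r) (x y : Bool) :
    (presentation p q r hp hr x y).HasDisk (grayNode p q r) :=
  hasDisk_head (bands_Q_mem hp hr x y).1

theorem chord_zero_ne_one (hp : 1 ≤ p) : chord p q r 0 ≠ chord p q r 1 := by
  intro h
  have := congrArg Fin.val h
  rw [val_chord (by omega), val_chord (by omega)] at this
  omega

/-- What `P(Θ(p,q,r))` and the presentations obtained from it by canceling cross-changes have in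
common: the part `Q`, and the marked crossings with the white disks. -/
structure HasThetaShape (p q r : ℕ) (x : Bool) (P : RibbonPresentation (p + q + r + 1)) : Prop where
  band₁ : ⟨whiteDisk₁ p q r, grayNode p q r, []⟩ ∈ P.bands
  band₂ : ⟨whiteDisk₂ p q r, grayNode p q r, []⟩ ∈ P.bands
  head : ∀ b ∈ P.bands, b.head = RibbonDisk.base ∨ b.head = grayNode p q r
  isNode : P.IsNode (grayNode p q r)
  crosses : ∀ b ∈ P.bands, ∀ c ∈ b.word, ∀ j, c.disk = RibbonDisk.white j →
    c.star = some j ∧ Crosses p q r x b.tail j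

theorem hasThetaShape_presentation (hp : 1 ≤ p) (hr : 1 ≤ r) (x y : Bool) :
    HasThetaShape p q r x (presentation p q r hp hr x y) := by
  have h := bands_Q_mem (q := q) hp hr x y
  refine ⟨h.1, h.2, ?_, ⟨hasDisk_grayNode hp hr x y, ?_⟩, ?_⟩
  · intro b hb
    rcases mem_bands_presentation hp hr x y hb with (rfl | rfl) | ⟨h, -⟩
    · exact Or.inr rfl
    · exact Or.inr rfl
    · exact Or.inl h
  · intro b hb c hc
    rcases mem_bands_presentation hp hr x y hb with (rfl | rfl) | ⟨-, h⟩
    · simp at hc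
    · simp at hc
    · obtain ⟨j, rfl, -⟩ := h c hc
      simp [grayNode]
  · intro b hb c hc j hj
    rcases mem_bands_presentation hp hr x y hb with (rfl | rfl) | ⟨-, h⟩
    · simp at hc
    · simp at hc
    · obtain ⟨i, rfl, h⟩ := h c hc
      cases hj
      exact ⟨rfl, h⟩

/-- The new disk is an `extra` one attached to the gray disk, and the only new crossing is with it;
the shape restricts neither beyond its head and its not being the gray node. -/
theorem HasThetaShape.cancelingChange {x : Bool} {P R : RibbonPresentation (p + q + r + 1)}
    {j : Fin (p + q + r + 1)} {n : ℕ} (hP : HasThetaShape p q r x P)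
    (h : CancelingChange (grayNode p q r) j (RibbonDisk.extra n) P R) :
    HasThetaShape p q r x R := by
  refine ⟨h.mem_of_mem _ hP.band₁ rfl, h.mem_of_mem _ hP.band₂ rfl, ?_,
    ⟨hasDisk_head (h.mem_of_mem _ hP.band₁ rfl), ?_⟩, ?_⟩
  · intro b hb
    rcases h.exists_of_mem b hb with rfl | ⟨a, ha, -, h, -⟩
    · exact Or.inr rfl
    · exact h ▸ hP.head a ha
  · intro b hb c hc
    rcases h.exists_of_mem b hb with rfl | ⟨a, ha, -, -, h⟩
    · simp at hc
    · rcases h c hc with h | ⟨h, -⟩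
      · exact hP.isNode.2 a ha c h
      · simp [h, grayNode]
  · intro b hb c hc i hi
    rcases h.exists_of_mem b hb with rfl | ⟨a, ha, hab, -, h⟩
    · simp at hc
    · rcases h c hc with h | ⟨h, -⟩
      · exact hab ▸ hP.crosses a ha c h i hi
      · simp [hi] at h

theorem HasThetaShape.hasPartQ_resolve {x : Bool} {P : RibbonPresentation (p + q + r + 1)}
    (hP : HasThetaShape p q r x P) (ε : Fin (p + q + r + 1) → ℤˣ) :
    (P.resolve ε).HasPartQ (whiteDisk₁ p q r) (whiteDisk₂ p q r) (grayNode p q r) := by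
  refine ⟨List.mem_map.2 ⟨_, hP.band₁, rfl⟩, List.mem_map.2 ⟨_, hP.band₂, rfl⟩, ?_, ?_,
    hasDisk_resolve.2 hP.isNode.1, ?_⟩
  · intro b hb
    obtain ⟨a, ha, rfl⟩ := List.mem_map.1 hb
    rcases hP.head a ha with h | h <;> simp [resolveBand, h, whiteDisk₁, grayNode]
  · intro b hb
    obtain ⟨a, ha, rfl⟩ := List.mem_map.1 hb
    rcases hP.head a ha with h | h <;> simp [resolveBand, h, whiteDisk₂, grayNode]
  · intro b hb c hc
    obtain ⟨a, ha, rfl⟩ := List.mem_map.1 hb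
    obtain ⟨c', hc', h⟩ := List.mem_filterMap.1 hc
    rw [disk_of_resolveCrossing h]
    exact hP.isNode.2 a ha c' hc'

/-- Every crossing with a white disk carries the label of its chord, so it survives only if the sign
there is `1`. -/
theorem HasThetaShape.crosses_resolve {x : Bool} {P : RibbonPresentation (p + q + r + 1)}
    (hP : HasThetaShape p q r x P) {ε : Fin (p + q + r + 1) → ℤˣ}
    {b : RibbonBand (p + q + r + 1)} (hb : b ∈ (P.resolve ε).bands)
    {c : RibbonCrossing (p + q + r + 1)} (hc : c ∈ b.word) {j : Fin (p + q + r + 1)}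
    (hj : c.disk = RibbonDisk.white j) : ε j = 1 ∧ Crosses p q r x b.tail j := by
  obtain ⟨a, ha, rfl⟩ := List.mem_map.1 hb
  obtain ⟨c', hc', h⟩ := List.mem_filterMap.1 hc
  rw [disk_of_resolveCrossing h] at hj
  obtain ⟨h1, h2⟩ := hP.crosses a ha c' hc' j hj
  refine ⟨?_, h2⟩
  by_contra hε
  simp [resolveCrossing, h1, hε] at h

/-! ### Freeing a white disk of `Q` when a sign is negative. -/

/-- If the crossing with the `i`-th white disk is removed, the disks following it on the way to one
of the white disks of `Q` can be deleted. -/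
theorem exists_deletable (hp : 1 ≤ p) (x : Bool) (i : Fin (p + q + r + 1)) :
    ∃ (T : ℕ → Prop) (t : ℕ), (t = 0 ∨ t = 1) ∧ (∀ j, T j → 2 ≤ j) ∧
      ∀ (d : RibbonDisk (p + q + r + 1)) (j : ℕ), j ≠ i.1 → Crosses p q r x d j → (T j ∨ j = t) →
        ∃ m : Fin (p + q + r + 1), d = RibbonDisk.white m ∧ T m ∧ (T j → m.1 < j) := by
  rcases Nat.lt_or_ge i.1 2 with h2 | h2
  -- The removed crossing was with a white disk of `Q` itself, so nothing has to be deleted.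
  · exact ⟨fun _ => False, i.1, by omega, by simp, fun d j hj _ h => absurd h (by simpa using hj)⟩
  by_cases hm : p < i.1 ∧ i.1 ≤ p + q
  -- Along the middle edge the deletions run through the chords `i, …, p + q`; the last of these
  -- lines crosses the white disk of chord `1` or `0`, according to `x`.
  · refine ⟨fun j => 2 ≤ j ∧ i.1 ≤ j ∧ j ≤ p + q, if x then 1 else 0, by cases x <;> simp,
      fun j h => h.1, ?_⟩
    rintro d j hj (⟨rfl, h⟩ | ⟨m, rfl, h⟩) hT
    · exfalso
      cases x <;> simp [upperIn] at h hT <;> split_ifs at h <;> omega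
    · refine ⟨m, rfl, ?_⟩
      have := m.2
      cases x <;> simp [upperIn, middleIn, lowerIn] at h hT ⊢ <;> split_ifs at h <;> omega
  -- From the upper or lower edge, the deletions follow the upper chords and then the lower ones,
  -- skipping the middle edge, and end at the other white disk of `Q`.
  · refine ⟨fun j => 2 ≤ j ∧ i.1 ≤ j ∧ (j ≤ p ∨ p + q < j), if x then 0 else 1,
      by cases x <;> simp, fun j h => h.1, ?_⟩
    rintro d j hj (⟨rfl, h⟩ | ⟨m, rfl, h⟩) hT
    -- The gray disk crosses chord `2`, or `p + q + 1` if `p = 1`. This lies in the deleted range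
    -- only if it equals `i`, whose crossing is gone.
    · exfalso
      cases x <;> simp [upperIn] at h hT <;> split_ifs at h <;> omega
    · refine ⟨m, rfl, ?_⟩
      have := m.2
      cases x <;> simp [upperIn, middleIn, lowerIn] at h hT ⊢ <;> split_ifs at h <;> omega

/-- The disks given by `exists_deletable` are deleted in order of chord number. Every band still
crossing the chosen white disk of `Q` would start at a deleted disk. -/
theorem HasThetaShape.exists_node (hp : 1 ≤ p) {x : Bool}
    {P : RibbonPresentation (p + q + r + 1)} (hP : HasThetaShape p q r x P)
    (ε : Fin (p + q + r + 1) → ℤˣ) (hε : ∃ i, ε i = -1) :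
    ∃ R : RibbonPresentation (p + q + r + 1),
      EquivalentKeepingQ (whiteDisk₁ p q r) (whiteDisk₂ p q r) (grayNode p q r) (P.resolve ε) R ∧
      R.HasPartQ (whiteDisk₁ p q r) (whiteDisk₂ p q r) (grayNode p q r) ∧
      (R.IsNode (whiteDisk₁ p q r) ∨ R.IsNode (whiteDisk₂ p q r)) := by
  obtain ⟨i, hi⟩ := hε
  obtain ⟨T, t, ht, hT, hd⟩ := exists_deletable hp x i
  have hne : ∀ j, ε j = 1 → j.1 ≠ i.1 := by
    intro j hj h
    rw [Fin.ext h, hi] at hj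
    exact absurd hj (by decide)
  -- Chords `0` and `1` are outside the deleted range, so `Q` stays intact.
  have hnot : ∀ n, n < 2 → ¬ ∃ j : Fin (p + q + r + 1),
      (RibbonDisk.white (chord p q r n) : RibbonDisk (p + q + r + 1)) = RibbonDisk.white j ∧
        T j := by
    rintro n hn ⟨j, hj, hTj⟩
    cases hj
    have := hT _ hTj
    rw [val_chord (by omega)] at this
    omega
  obtain ⟨R, hsub, hS, hQ, hR⟩ := (P.resolve ε).exists_deletion_keepingQ
    (fun d => ∃ j : Fin (p + q + r + 1), d = RibbonDisk.white j ∧ T j)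
    (fun d => match d with
      | RibbonDisk.white j => j.1
      | _ => 0)
    (hP.hasPartQ_resolve ε) (hnot 0 (by omega)) (hnot 1 (by omega)) (by simp [grayNode]) (by
      rintro b hb _ ⟨j, rfl, hj⟩ (⟨c, hc, hcj⟩ | hh)
      · obtain ⟨h1, h2⟩ := hP.crosses_resolve hb hc hcj
        obtain ⟨m, hm, hTm, hlt⟩ := hd _ _ (hne j h1) h2 (Or.inl hj)
        exact ⟨⟨m, hm, hTm⟩, by rw [hm]; exact hlt hj⟩
      · obtain ⟨a, ha, rfl⟩ := List.mem_map.1 hb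
        rcases hP.head a ha with h | h <;> simp [resolveBand, h, grayNode] at hh)
  refine ⟨R, hR, hQ, ?_⟩
  have hnode : ∀ b ∈ R.bands, ∀ c ∈ b.word, c.disk ≠ RibbonDisk.white (chord p q r t) := by
    intro b hb c hc hcd
    obtain ⟨h1, h2⟩ := hP.crosses_resolve (hsub hb) hc hcd
    obtain ⟨m, hm, hTm, -⟩ := hd _ _ (hne _ h1) h2 (Or.inr (val_chord (by omega)))
    exact hS b hb ⟨m, hm, hTm⟩
  rcases ht with rfl | rfl
  · exact Or.inl ⟨hasDisk_tail hQ.band₁, hnode⟩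
  · exact Or.inr ⟨hasDisk_tail hQ.band₂, hnode⟩

/-- Without the crossings with the white disks of `Q`, the presentation is trivial. -/
theorem equivalent_trivial_resolve (hp : 1 ≤ p) (hr : 1 ≤ r) (x y : Bool)
    (ε : Fin (p + q + r + 1) → ℤˣ) (h₀ : ε (chord p q r 0) ≠ 1) (h₁ : ε (chord p q r 1) ≠ 1) :
    ((presentation p q r hp hr x y).resolve ε).Equivalent (trivialPresentation _) := by
  -- The uncrossed white disks of `Q` get rank `0`, below the gray disk with rank `1`. The other
  -- white disks are ranked by chord number, except that the middle ones are shifted by `p + q + 2`: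
  -- chord `p + 1` is crossed by the line of chord `p + q + 1`, so the middle edge must come after
  -- the first lower hair.
  refine RibbonPresentation.equivalent_trivial (fun d => match d with
      | RibbonDisk.white j => if j.1 < 2 then 0 else if p < j.1 ∧ j.1 ≤ p + q then j.1 + p + q + 2
          else j.1
      | RibbonDisk.gray _ => 1
      | _ => 0) _ ?_
  intro b hb d hd h
  obtain ⟨a, ha, rfl⟩ := List.mem_map.1 hb
  have hP := hasThetaShape_presentation (q := q) hp hr x y
  rcases h with ⟨c, hc, rfl⟩ | rfl
  · have hw : ∃ j, c.disk = RibbonDisk.white j := by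
      obtain ⟨c', hc', h⟩ := List.mem_filterMap.1 hc
      rw [disk_of_resolveCrossing h]
      rcases mem_bands_presentation hp hr x y ha with (rfl | rfl) | ⟨-, h⟩
      · simp at hc'
      · simp at hc'
      · obtain ⟨j, rfl, -⟩ := h c' hc'
        exact ⟨j, rfl⟩
    obtain ⟨j, hj⟩ := hw
    obtain ⟨h1, h2⟩ := hP.crosses_resolve hb hc hj
    have hj2 : 2 ≤ j.1 := by
      by_contra hlt
      rcases (by omega : j.1 = 0 ∨ j.1 = 1) with h | h
      · exact h₀ (by rwa [show chord p q r 0 = j from Fin.ext ((val_chord (by omega)).trans h.symm)])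
      · exact h₁ (by rwa [show chord p q r 1 = j from Fin.ext ((val_chord (by omega)).trans h.symm)])
    rw [hj]
    rcases h2 with ⟨h, h2⟩ | ⟨m, h, h2⟩
    · rw [h]
      simp only [grayNode]
      split_ifs <;> omega
    · rw [h]
      cases x <;> simp [upperIn, middleIn, lowerIn] at h2 ⊢ <;> split_ifs at h2 ⊢ <;> omega
  · rcases mem_bands_presentation hp hr x y ha with (rfl | rfl) | ⟨h, -⟩
    · simp [resolveBand, whiteDisk₁, grayNode, val_chord (p := p) (q := q) (r := r) (n := 0)]
    · simp [resolveBand, whiteDisk₂, grayNode,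
        val_chord (p := p) (q := q) (r := r) (n := 1) (by omega)]
    · exact absurd h hd

end Theta

/-! ### Two cancelling cross-changes at the gray node. -/

theorem mainTheorem6 (p q r : ℕ) (hp : 1 ≤ p) (hr : 1 ≤ r) (x y : Bool) :
    ∃ P' : RibbonPresentation (p + q + r + 1),
      Relation.ReflTransGen (RibbonPresentation.CrossChange (Theta.grayNode p q r))
        (Theta.presentation p q r hp hr x y) P' ∧
      (P'.resolve fun _ => 1).Equivalent (RibbonPresentation.trivialPresentation _) ∧
      ∀ P ∈ ({Theta.presentation p q r hp hr x y, P'} : Set (RibbonPresentation (p + q + r + 1))),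
        ∀ ε : Fin (p + q + r + 1) → ℤˣ, (∃ i, ε i = -1) →
          ∃ R : RibbonPresentation (p + q + r + 1),
            RibbonPresentation.EquivalentKeepingQ
              (Theta.whiteDisk₁ p q r) (Theta.whiteDisk₂ p q r) (Theta.grayNode p q r)
              (P.resolve ε) R ∧
            R.HasPartQ
              (Theta.whiteDisk₁ p q r) (Theta.whiteDisk₂ p q r) (Theta.grayNode p q r) ∧
            (R.IsNode (Theta.whiteDisk₁ p q r) ∨ R.IsNode (Theta.whiteDisk₂ p q r)) := by
  have hP := Theta.hasThetaShape_presentation (q := q) hp hr x y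
  have hst : (Theta.presentation p q r hp hr x y).stars.Nodup :=
    ChordDiagram.stars_ribbon_nodup _ _
  obtain ⟨m, hm⟩ := (Theta.presentation p q r hp hr x y).exists_extra
  obtain ⟨P₁, h₁⟩ := RibbonPresentation.exists_cancelingChange _ hP.isNode hm hst hP.band₁
    (ChordDiagram.exists_crossing_ribbon _ _ _)
  have hP₁ := hP.cancelingChange h₁
  obtain ⟨n, hn⟩ := P₁.exists_extra
  -- The first change keeps all labelled crossings and their labels, so a second one can be made at
  -- chord `1`.
  obtain ⟨P₂, h₂⟩ := RibbonPresentation.exists_cancelingChange P₁ hP₁.isNode hn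
    (h₁.stars_eq ▸ hst) hP₁.band₂ (by
      obtain ⟨b, hb, c, hc, h⟩ := ChordDiagram.exists_crossing_ribbon
        (Theta.diagram p q r hp hr x y) (fun _ => 1) (Theta.chord p q r 1)
      obtain ⟨a, ha, hca⟩ := h₁.exists_crossing b hb c hc
      exact ⟨a, ha, c, hca, h⟩)
  have hP₂ := hP₁.cancelingChange h₂
  refine ⟨P₂, .tail (.single h₁.crossChange) h₂.crossChange, ?_, ?_⟩
  -- Undoing the changes in reverse order turns the signs of chords `1` and `0` into `-1`; the sign
  -- of chord `0` is still `1` when its turn comes.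
  · refine (h₂.equivalent _ rfl).trans ((h₁.equivalent _ ?_).trans
      (Theta.equivalent_trivial_resolve hp hr x y _ ?_ ?_))
    · rw [Function.update_of_ne (Theta.chord_zero_ne_one hp)]
    · rw [Function.update_self]
      decide
    · rw [Function.update_of_ne (Theta.chord_zero_ne_one hp).symm, Function.update_self]
      decide
  · rintro P (rfl | rfl) ε hε
    · exact hP.exists_node hp ε hε
    · exact hP₂.exists_node hp ε hε
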